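/- **Theorem 3.1.** For $m\in\mathbb Z$ let $e_m(\phi)=\frac1{\sqrt{2\pi}}e^{\mathrm i m\phi}$ and $(f\otimes e_m)(\theta,\phi)=f(\theta)e_m(\phi)$. Let $P_n^m(x)=\frac{(-1)^m}{2^n n!}(1-x^2)^{m/2}\frac{d^{m+n}}{dx^{m+n}}(x^2-1)^n$ for $0\le m\le n$, and $$Q_n^m(\theta)=Q_n^{-m}(\theta)=\Big(\tfrac{2n+1}{2}\tfrac{(n-m)!}{(n+m)!}\Big)^{1/2}P_n^m(\cos\theta),\quad 0\le m\le n,\qquad Y_n^m(\theta,\phi)=(-1)^{(m+|m|)/2}Q_n^m(\theta)e_m(\phi),\quad |m|\le n.$$ Let $\mathcal H^0$ be the space of measurable $F:\mathbb R^2\to\mathbb C$ with $F(\theta,\phi)=F(\theta+2\pi,\phi)=F(\theta,\phi+2\pi)=F(-\theta,\phi+\pi)$ for almost all $(\theta,\phi)$ and $\int_0^\pi\int_0^{2\pi}|F|^2\sin\theta\,d\phi\,d\theta<\infty$. Put $\widehat F_{n,m}=\int_0^\pi\int_0^{2\pi}F\,\overline{Y_n^m}\sin\theta\,d\phi\,d\theta$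 and, for $s\ge0$, $$\|F\|_{\mathcal H^s}^2=\sum_{n=0}^\infty\sum_{|m|\le n}(n+\tfrac12)^{2s}|\widehat F_{n,m}|^2\in[0,\infty],\qquad \mathcal H^s=\{F\in\mathcal H^0:\|F\|_{\mathcal H^s}<\infty\},$$ $$W_m^s=\{f\in L^1_{\rm loc}(\mathbb R): f\otimes e_m\in\mathcal H^s\},\qquad \|f\|_{W_m^s}=\|f\otimes e_m\|_{\mathcal H^s}\in[0,\infty].$$ The last quantity depends only on the values of $f$ in $(0,\pi)$; it makes sense, by the same formula, for every $f\in W_k^0$ and every $k\in\mathbb Z$, also when $k\ne m$. With $f',f''$ the weak derivatives of $f$ on $(0,\pi)$, define the following quantities in $[0,\infty]$ (with value $\infty$ if a weak derivative that occurs does not exist as a locally integrable function): $$\|f\|_{Z_0^1}^2=\tfrac14\int_0^\pi|f|^2\sin\theta\,d\theta+\int_0^\pi|f'|^2\sin\theta\,d\theta,$$ and, for $m\ne0$, $$\|f\|_{Z_m^1}^2=m^2\int_0^\pi|f|^2\frac{d\theta}{\sin\theta}+\int_0^\pi|f'|^2\sin\theta\,d\theta,$$ $$\|f\|_{Z_m^2}^2=m^4\int_0^\pi|f|^2\frac{d\theta}{\sin^3\theta}+m^2\int_0^\pi|f'|^2\frac{d\theta}{\sin\theta}+\int_0^\pi|f''|^2\sin\theta\,d\theta.$$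 Then the following hold in $[0,\infty]$. 1. $\|f\|_{W_0^1}=\|f\|_{Z_0^1}$ for all $f\in W_0^0$. 2. For all $m\in\mathbb Z$ with $|m|\ge1$ and all $f\in W_m^0$, $$\|f\|_{W_0^1}=\|f\|_{Z_0^1}\le\|f\|_{W_m^1}\le\tfrac{\sqrt5}{2}\|f\|_{Z_m^1}\le\tfrac{\sqrt5}{2}\|f\|_{W_m^1}.$$ 3. For all $m\in\mathbb Z$ with $|m|\ge2$ and all $f\in W_m^0$, $$\tfrac1{\sqrt3}\|f\|_{W_m^2}\le\|f\|_{Z_m^2}\le\sqrt3\,\|f\|_{W_m^2}.$$ In particular, for $f\in W_m^0$: $f\in W_m^1$ if and only if $\|f\|_{Z_m^1}<\infty$ (for $|m|\ge1$), and $f\in W_m^2$ if and only if $\|f\|_{Z_m^2}<\infty$ (for $|m|\ge2$). -/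

import Mathlib

open MeasureTheory Set

noncomputable section

namespace SphereSobolev

/-- The associated Legendre function
`P_n^m(x) = (-1)^m / (2^n n!) (1 - x^2)^(m/2) (d/dx)^(m+n) (x^2 - 1)^n`, for `m ≥ 0`. -/
def legendreP (n m : ℕ) (x : ℝ) : ℝ :=
  (-1) ^ m / (2 ^ n * (n.factorial : ℝ)) * √(1 - x ^ 2) ^ m *
    ((Polynomial.derivative^[m + n] ((Polynomial.X ^ 2 - 1 : Polynomial ℝ) ^ n)).eval x)

/-- The normalized associated Legendre functions `Q_n^m(θ)`, with `Q_n^{-m} = Q_n^m`,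
used for `|m| ≤ n`. -/
def legendreQ (n : ℕ) (m : ℤ) (θ : ℝ) : ℝ :=
  √((2 * (n : ℝ) + 1) / 2 *
      (((n - m.natAbs).factorial : ℝ) / ((n + m.natAbs).factorial : ℝ))) *
    legendreP n m.natAbs (Real.cos θ)

/-- `e_m(φ) = exp(i m φ) / √(2π)`. -/
def expMode (m : ℤ) (φ : ℝ) : ℂ :=
  (1 / √(2 * Real.pi) : ℝ) * Complex.exp (Complex.I * (m : ℂ) * (φ : ℂ))

/-- The spherical harmonics `Y_n^m` in the coordinates `(θ, φ)`, used for `|m| ≤ n`.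
The integer `m + |m|` is even, so that the division is exact. -/
def sphericalY (n : ℕ) (m : ℤ) (θ φ : ℝ) : ℂ :=
  (-1 : ℂ) ^ ((m + |m|) / 2) * (legendreQ n m θ : ℂ) * expMode m φ

/-- The function `F` on `ℝ²` represents (almost everywhere) a function on the unit sphere through
the parametrization `p(θ, φ) = (sin θ cos φ, sin θ sin φ, cos θ)`. -/
def IsSpherical (F : ℝ × ℝ → ℂ) : Prop :=
  ∀ᵐ p : ℝ × ℝ, F (p.1 + 2 * Real.pi, p.2) = F p ∧ F (p.1, p.2 + 2 * Real.pi) = F p ∧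
    F (-p.1, p.2 + Real.pi) = F p

/-- Membership in `H⁰`, that is, in `L²` of the sphere. -/
def MemH0 (F : ℝ × ℝ → ℂ) : Prop :=
  AEStronglyMeasurable F ∧ IsSpherical F ∧
    ∫⁻ p in Ioo 0 Real.pi ×ˢ Ioo 0 (2 * Real.pi), ‖F p‖ₑ ^ 2 * ENNReal.ofReal (Real.sin p.1) < ⊤

/-- The Fourier coefficients with respect to the spherical harmonics. -/
def sphCoeff (F : ℝ × ℝ → ℂ) (n : ℕ) (m : ℤ) : ℂ :=
  ∫ θ in (0 : ℝ)..Real.pi, ∫ φ in (0 : ℝ)..(2 * Real.pi),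
    F (θ, φ) * (starRingEnd ℂ) (sphericalY n m θ φ) * (Real.sin θ : ℂ)

/-- The Sobolev norm of order `s` on the sphere, with values in `[0, ∞]`:
`‖F‖² = ∑_{n ≥ 0} ∑_{|m| ≤ n} (n + 1/2)^(2s) |F̂_{n,m}|²`. -/
def hNorm (s : ℝ) (F : ℝ × ℝ → ℂ) : ENNReal :=
  (∑' n : ℕ, ∑ m ∈ Finset.Icc (-(n : ℤ)) (n : ℤ),
    ENNReal.ofReal (((n : ℝ) + 1 / 2) ^ (2 * s)) * ‖sphCoeff F n m‖ₑ ^ 2) ^ (1 / 2 : ℝ)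

/-- Membership in the Sobolev space `H^s` on the sphere, for `s ≥ 0`
(as a subspace of `H⁰`, with which the completion of the span of the `Y_n^m` is identified). -/
def MemH (s : ℝ) (F : ℝ × ℝ → ℂ) : Prop :=
  MemH0 F ∧ hNorm s F < ⊤

/-- `(f ⊗ e_m)(θ, φ) = f(θ) e_m(φ)`. -/
def tensorMode (f : ℝ → ℂ) (m : ℤ) (p : ℝ × ℝ) : ℂ :=
  f p.1 * expMode m p.2

/-- The space `W_m^s` of the functions `f ∈ L¹_loc(ℝ)` with `f ⊗ e_m ∈ H^s`, for `s ≥ 0`. -/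
def W (m : ℤ) (s : ℝ) : Set (ℝ → ℂ) :=
  {f | LocallyIntegrable f ∧ MemH s (tensorMode f m)}

/-- `‖f‖_{W_m^s} = ‖f ⊗ e_m‖_{H^s}`, with values in `[0, ∞]`. It depends only on the values
of `f` in `(0, π)`. -/
def wNorm (m : ℤ) (s : ℝ) (f : ℝ → ℂ) : ENNReal :=
  hNorm s (tensorMode f m)

/-- `g` is the weak (distributional) derivative of `f` on the open interval `(0, π)`. -/
def HasWeakDeriv (f g : ℝ → ℂ) : Prop :=
  LocallyIntegrableOn f (Ioo 0 Real.pi) ∧ LocallyIntegrableOn g (Ioo 0 Real.pi) ∧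
    ∀ η : ℝ → ℝ, ContDiff ℝ (⊤ : ℕ∞) η → HasCompactSupport η → tsupport η ⊆ Ioo 0 Real.pi →
      ∫ θ in Ioo 0 Real.pi, ((deriv η θ : ℝ) : ℂ) * f θ = - ∫ θ in Ioo 0 Real.pi, (η θ : ℂ) * g θ

/-- `∫_0^π |f|² sin^k dθ` for an integer `k`, with values in `[0, ∞]`. -/
def sinInt (k : ℤ) (f : ℝ → ℂ) : ENNReal :=
  ∫⁻ θ in Ioo 0 Real.pi, ‖f θ‖ₑ ^ 2 * ENNReal.ofReal (Real.sin θ ^ k)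

/-- `‖f‖_{Z_0^1}`, with values in `[0, ∞]`. The weak derivative `g = f'` is unique almost
everywhere, so that the infimum is the value at it, and `∞` if there is none. -/
def zNormZero (f : ℝ → ℂ) : ENNReal :=
  ⨅ (g : ℝ → ℂ) (_ : HasWeakDeriv f g),
    (ENNReal.ofReal (1 / 4) * sinInt 1 f + sinInt 1 g) ^ (1 / 2 : ℝ)

/-- `‖f‖_{Z_m^1}` for `m ≠ 0`, with values in `[0, ∞]`, where `g = f'`. -/
def zNormOne (m : ℤ) (f : ℝ → ℂ) : ENNReal :=
  ⨅ (g : ℝ → ℂ) (_ : HasWeakDeriv f g),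
    (ENNReal.ofReal ((m : ℝ) ^ 2) * sinInt (-1) f + sinInt 1 g) ^ (1 / 2 : ℝ)

/-- `‖f‖_{Z_m^2}` for `m ≠ 0`, with values in `[0, ∞]`, where `g = f'` and `h = f''`. -/
def zNormTwo (m : ℤ) (f : ℝ → ℂ) : ENNReal :=
  ⨅ (g : ℝ → ℂ) (h : ℝ → ℂ) (_ : HasWeakDeriv f g ∧ HasWeakDeriv g h),
    (ENNReal.ofReal ((m : ℝ) ^ 4) * sinInt (-3) f + ENNReal.ofReal ((m : ℝ) ^ 2) * sinInt (-1) g +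
      sinInt 1 h) ^ (1 / 2 : ℝ)

end SphereSobolev

end

open SphereSobolev

noncomputable section

namespace SphereSobolev

/-! Tensoring with e_m leaves only harmonics of order m. With M = |m| and n = M + j, the squared
W-norm is therefore Σ_j (n + 1/2)^(2s) |a_j|², where a_j is the coefficient of f against the
normalized Legendre function q_j (`wNorm_eq`). The q_j form a Hilbert basis of L²(sin θ dθ) on (0,
π) (`SqInt.hasSum_smoothQ`) and are eigenfunctions of A u = -u'' - cot u' + M² u / sin² with
eigenvalue n(n + 1) = (n + 1/2)² - 1/4. The theorem compares the spectral series with weighted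
integrals.

Order one. The quadratic form of A is ∫ |u'|² sin + M² ∫ |u|² / sin, so the pairs (q_j', M q_j /
sin) are orthogonal with squared lengths n(n + 1) (`inner_formVec`). If the integrals for f are
finite, the weak eigenvalue equation and Bessel's inequality bound the series by 1/4 ∫ |f|² sin + M²
∫ |f|² / sin + ∫ |f'|² sin (`tsum_coeff_le_first_order`). If the series is finite, the expansions of
f' and M f / sin converge, and closedness of differentiation and multiplication identifies their
limits, which gives the reverse bound (`exists_weakDeriv_first_order`). The claims of order one
follow by taking M = 0, by dropping terms, and by sin ≤ 1 / sin.

Order two. The function A f + f / 4 has coefficients (n + 1/2)² a_j, and a pointwise estimate of it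
gives one inequality (`tsum_coeff_le_second_order`). For the other, let p be a finite combination of
the q_j: up to the derivative of a function vanishing at both poles, 3 (A p)² sin minus the density
of the squared Z-norm is a sum of squares with nonnegative weights as soon as M ≥ 2
(`second_order_energy`). The bound passes to the limit in `exists_weakDeriv_second_order`.

The Z-norms are infima over weak derivatives. Bounds from below hold for each candidate and bounds
from above exhibit one, so uniqueness of weak derivatives plays no role. -/

/-! ### Derivatives of (x² - 1)^n and their differential equation -/

open Polynomial in
/-- The polynomial factor of the associated Legendre function, up to normalization. -/
def legendreW (M n : ℕ) : Polynomial ℝ := derivative^[M + n] ((X ^ 2 - 1 : Polynomial ℝ) ^ n)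

-- With u = (x² - 1)^n, the relation (x² - 1) u' = 2 n x u differentiated once is the case k = 0;
-- each further derivative raises k by one.
open Polynomial in
theorem iterate_derivative_ode (n k : ℕ) :
    (X ^ 2 - 1 : Polynomial ℝ) * derivative^[k + 2] ((X ^ 2 - 1 : Polynomial ℝ) ^ n) +
      (2 * ((k : Polynomial ℝ) + 1) - 2 * (n : Polynomial ℝ)) * X *
        derivative^[k + 1] ((X ^ 2 - 1 : Polynomial ℝ) ^ n) +
      ((k : Polynomial ℝ) + 1) * ((k : Polynomial ℝ) - 2 * (n : Polynomial ℝ)) *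
        derivative^[k] ((X ^ 2 - 1 : Polynomial ℝ) ^ n) = 0 := by
  induction k with
  | zero =>
    have h1 : (X ^ 2 - 1 : Polynomial ℝ) * derivative ((X ^ 2 - 1 : Polynomial ℝ) ^ n) =
        2 * (n : Polynomial ℝ) * X * (X ^ 2 - 1 : Polynomial ℝ) ^ n := by
      rcases n with _ | n
      · simp
      · simp only [derivative_pow, derivative_sub, derivative_X, derivative_one, map_natCast,
          Nat.add_sub_cancel]
        push_cast
        ring
    have h2 := congrArg derivative h1
    simp only [derivative_mul, derivative_sub, derivative_X_sq, derivative_one, derivative_X,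
      derivative_natCast, derivative_ofNat] at h2
    simp only [Function.iterate_succ, Function.comp, Function.iterate_zero, id] at h2 ⊢
    simp only [map_ofNat] at h2
    push_cast
    linear_combination h2
  | succ k ih =>
    have h2 := congrArg derivative ih
    simp only [derivative_mul, derivative_add, derivative_sub, derivative_X_sq, derivative_one,
      derivative_X, derivative_natCast, derivative_ofNat, derivative_zero,
      ← Function.iterate_succ_apply' derivative] at h2
    simp only [map_ofNat] at h2
    push_cast
    linear_combination h2

open Polynomial in
theorem legendreW_ode (M n : ℕ) (x : ℝ) :
    (1 - x ^ 2) * ((derivative (derivative (legendreW M n))).eval x) =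
      2 * (M + 1) * x * (derivative (legendreW M n)).eval x -
        ((n : ℝ) - M) * (n + M + 1) * (legendreW M n).eval x := by
  have h := congrArg (Polynomial.eval x) (iterate_derivative_ode n (M + n))
  simp only [Function.iterate_succ_apply' derivative] at h
  rw [show derivative^[M + n] ((X ^ 2 - 1 : Polynomial ℝ) ^ n) = legendreW M n from rfl] at h
  simp at h
  linear_combination -h

open Polynomial in
theorem derivative_legendreW (M n : ℕ) :
    derivative (legendreW M n) = legendreW (M + 1) n := by
  rw [legendreW, legendreW, ← Function.iterate_succ_apply' derivative]
  congr 2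
  omega

-- Having exactly one polynomial in each degree j makes these a basis of all polynomials, which is
-- the algebraic half of completeness.
open Polynomial in
theorem degree_legendreW (M j : ℕ) : (legendreW M (M + j)).degree = j := by
  have hm : ((X ^ 2 - 1 : Polynomial ℝ) ^ (M + j)).Monic :=
    (by simpa using monic_X_pow_sub_C (1 : ℝ) two_ne_zero : (X ^ 2 - 1 : Polynomial ℝ).Monic).pow _
  have hd : ((X ^ 2 - 1 : Polynomial ℝ) ^ (M + j)).natDegree = 2 * (M + j) := by
    have := natDegree_X_pow_sub_C (n := 2) (r := (1 : ℝ))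
    simp only [map_one] at this
    rw [natDegree_pow, this, mul_comm]
  have hle : (legendreW M (M + j)).natDegree ≤ j := by
    refine (natDegree_iterate_derivative _ _).trans ?_
    rw [hd]; omega
  have hc : (legendreW M (M + j)).coeff j ≠ 0 := by
    have h1 : ((X ^ 2 - 1 : Polynomial ℝ) ^ (M + j)).coeff (j + (M + (M + j))) = 1 := by
      have := hm.coeff_natDegree
      rwa [hd, show 2 * (M + j) = j + (M + (M + j)) by ring] at this
    rw [legendreW, coeff_iterate_derivative, h1, nsmul_one]
    exact_mod_cast (Nat.descFactorial_pos.2 (by omega)).ne'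
  rw [degree_eq_natDegree (fun h => hc (by simp [h]))]
  exact_mod_cast le_antisymm hle (le_natDegree_of_ne_zero hc)

/-! ### Trigonometric polynomials and the norms of the Legendre functions -/

/-- `sin^k θ · p(cos θ)`. -/
def trigPoly (k : ℕ) (p : Polynomial ℝ) (θ : ℝ) : ℝ := Real.sin θ ^ k * p.eval (Real.cos θ)

theorem contDiff_trigPoly (k : ℕ) (p : Polynomial ℝ) {N : WithTop ℕ∞} :
    ContDiff ℝ N (trigPoly k p) := by
  have h : ContDiff ℝ N fun x : ℝ => p.eval x := by
    simpa using p.contDiff_aeval (𝕜 := ℝ) N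
  exact (Real.contDiff_sin.pow k).mul (h.comp Real.contDiff_cos)

theorem hasDerivAt_trigPoly (k : ℕ) (p : Polynomial ℝ) (θ : ℝ) :
    HasDerivAt (trigPoly k p)
      (k * Real.sin θ ^ (k - 1) * Real.cos θ * p.eval (Real.cos θ) -
        Real.sin θ ^ (k + 1) * (Polynomial.derivative p).eval (Real.cos θ)) θ := by
  have h1 := (Real.hasDerivAt_sin θ).pow k
  have h2 := (p.hasDerivAt (Real.cos θ)).comp θ (Real.hasDerivAt_cos θ)
  refine (h1.mul h2).congr_deriv ?_
  simp only [Function.comp, Pi.pow_apply]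
  ring

theorem integral_eq_zero_of_hasDerivAt {F F' : ℝ → ℝ} (h : ∀ x, HasDerivAt F (F' x) x)
    (hc : Continuous F') (h0 : F 0 = 0) (hπ : F Real.pi = 0) :
    ∫ θ in (0 : ℝ)..Real.pi, F' θ = 0 := by
  rw [intervalIntegral.integral_eq_sub_of_hasDerivAt (fun x _ => h x) (hc.intervalIntegrable _ _),
    h0, hπ, sub_zero]

/-- The squared norm of `sin^M · W` with respect to the weight `sin`. -/
def legendreN (M n : ℕ) : ℝ :=
  ∫ θ in (0 : ℝ)..Real.pi, Real.sin θ ^ (2 * M + 1) * (legendreW M n).eval (Real.cos θ) ^ 2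

/-- Since w' is the polynomial of order M + 1, integrating the derivative of sin^(2M+2) w w', which
vanishes at both poles, and inserting the differential equation relates the two norms. -/
theorem legendreN_succ (M n : ℕ) :
    legendreN (M + 1) n = ((n : ℝ) - M) * (n + M + 1) * legendreN M n := by
  set w := legendreW M n with hw
  have hcs : ∀ p : Polynomial ℝ, Continuous fun θ => p.eval (Real.cos θ) := fun p =>
    p.continuous.comp Real.continuous_cos
  have key := integral_eq_zero_of_hasDerivAt
    (F := trigPoly (2 * M + 2) (w * Polynomial.derivative w))
    (F' := fun θ => ((n : ℝ) - M) * (n + M + 1) * (Real.sin θ ^ (2 * M + 1) *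
        w.eval (Real.cos θ) ^ 2) - Real.sin θ ^ (2 * (M + 1) + 1) *
        (Polynomial.derivative w).eval (Real.cos θ) ^ 2) (fun θ => by
      refine (hasDerivAt_trigPoly _ _ _).congr_deriv ?_
      have ode := legendreW_ode M n (Real.cos θ)
      rw [← hw] at ode
      have hs : 1 - Real.cos θ ^ 2 = Real.sin θ ^ 2 := by rw [Real.sin_sq]
      rw [hs] at ode
      simp only [Polynomial.derivative_mul, Polynomial.eval_add, Polynomial.eval_mul]
      rw [show 2 * M + 2 - 1 = 2 * M + 1 by omega]
      push_cast
      linear_combination -(Real.sin θ ^ (2 * M + 1) * w.eval (Real.cos θ)) * ode)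
    (by have := hcs w; have := hcs (Polynomial.derivative w); fun_prop)
    (by simp [trigPoly]) (by simp [trigPoly])
  rw [intervalIntegral.integral_sub, intervalIntegral.integral_const_mul] at key
  · rw [legendreN, legendreN, ← derivative_legendreW, ← hw]
    linarith
  all_goals
    apply Continuous.intervalIntegrable
    have := hcs w; have := hcs (Polynomial.derivative w); fun_prop

theorem legendreN_mul_factorial (M n : ℕ) (h : M ≤ n) :
    legendreN M n * (n - M).factorial = (n + M).factorial * legendreN 0 n := by
  induction M with
  | zero => simp [mul_comm]
  | succ M ih =>
    have ih := ih (by omega)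
    obtain ⟨k, rfl⟩ : ∃ k, n = M + 1 + k := ⟨n - (M + 1), by omega⟩
    rw [show M + 1 + k - M = k + 1 by omega] at ih
    rw [legendreN_succ, show M + 1 + k - (M + 1) = k by omega,
      show M + 1 + k + (M + 1) = (M + 1 + k + M) + 1 by ring, Nat.factorial_succ]
    rw [Nat.factorial_succ] at ih
    push_cast at ih ⊢
    linear_combination ((M : ℝ) + 1 + k + M + 1) * ih

/-- The recursion in M is followed up to M = n, where the polynomial is the constant (2n)! and the
norm is the Wallis integral of sin^(2n+1). -/
theorem legendreN_zero (n : ℕ) :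
    legendreN 0 n = 2 * (2 ^ n * (n.factorial : ℝ)) ^ 2 / (2 * n + 1) := by
  have h1 := legendreN_mul_factorial n n le_rfl
  have hW : legendreW n n = Polynomial.C ((2 * n).factorial : ℝ) := by
    have h := Polynomial.eq_C_of_degree_eq_zero (degree_legendreW n 0)
    rw [add_zero] at h
    rw [h]
    congr 1
    rw [legendreW, Polynomial.coeff_iterate_derivative]
    have hm : ((Polynomial.X ^ 2 - 1 : Polynomial ℝ) ^ n).Monic :=
      (by simpa using Polynomial.monic_X_pow_sub_C (1 : ℝ) two_ne_zero :
        (Polynomial.X ^ 2 - 1 : Polynomial ℝ).Monic).pow _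
    have hd : ((Polynomial.X ^ 2 - 1 : Polynomial ℝ) ^ n).natDegree = n + n := by
      have := Polynomial.natDegree_X_pow_sub_C (n := 2) (r := (1 : ℝ))
      simp only [map_one] at this
      rw [Polynomial.natDegree_pow, this]; ring
    have h1 := hm.coeff_natDegree
    rw [hd] at h1
    rw [zero_add, h1, Nat.descFactorial_self, nsmul_one, two_mul]
  have hI : legendreN n n = ((2 * n).factorial : ℝ) ^ 2 *
      (2 * ∏ i ∈ Finset.range n, (2 * (i : ℝ) + 2) / (2 * i + 3)) := by
    rw [legendreN, ← integral_sin_pow_odd, hW, ← intervalIntegral.integral_const_mul]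
    simp [mul_comm]
  have hprod : ∀ n : ℕ, (∏ i ∈ Finset.range n, (2 * (i : ℝ) + 2) / (2 * i + 3)) *
      ((2 * n).factorial * (2 * n + 1)) = (2 ^ n * (n.factorial : ℝ)) ^ 2 := by
    intro n
    induction n with
    | zero => simp
    | succ n ih =>
      rw [Finset.prod_range_succ, show 2 * (n + 1) = 2 * n + 1 + 1 by ring, Nat.factorial_succ,
        Nat.factorial_succ, Nat.factorial_succ]
      push_cast
      rw [show (2 : ℝ) ^ (n + 1) * ((n + 1) * n.factorial) =
        2 * (n + 1) * (2 ^ n * n.factorial) by ring, mul_pow, ← ih]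
      field_simp
      ring
  have hf : ((2 * n).factorial : ℝ) ≠ 0 := by positivity
  rw [hI, Nat.sub_self, ← two_mul] at h1
  simp only [Nat.factorial_zero, Nat.cast_one, mul_one] at h1
  have h2 : legendreN 0 n = (2 * n).factorial *
      (2 * ∏ i ∈ Finset.range n, (2 * (i : ℝ) + 2) / (2 * i + 3)) := by
    apply mul_left_cancel₀ hf
    rw [← h1]; ring
  rw [h2, ← hprod n]
  field_simp

/-! ### Smooth normalized Legendre functions and the Legendre equation -/

/-- The normalization constant of `legendreQ (M + j) M`. -/
def legendreK (M j : ℕ) : ℝ :=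
  √((2 * ((M + j : ℕ) : ℝ) + 1) / 2 * ((j.factorial : ℝ) / ((M + j + M).factorial : ℝ))) *
    ((-1) ^ M / (2 ^ (M + j) * ((M + j).factorial : ℝ)))

theorem legendreK_sq_mul (M j : ℕ) : legendreK M j ^ 2 * legendreN M (M + j) = 1 := by
  have h := legendreN_mul_factorial M (M + j) (by omega)
  rw [legendreN_zero, Nat.add_sub_cancel_left] at h
  have hj : (j.factorial : ℝ) ≠ 0 := by positivity
  have hN : legendreN M (M + j) = (M + j + M).factorial *
      (2 * (2 ^ (M + j) * ((M + j).factorial : ℝ)) ^ 2 / (2 * (M + j : ℕ) + 1)) / j.factorial := by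
    rw [← h]; field_simp
  have h1 : ((-1 : ℝ) ^ M) ^ 2 = 1 := by rw [← pow_mul, mul_comm, pow_mul]; simp
  rw [legendreK, mul_pow, Real.sq_sqrt (by positivity), div_pow, h1, hN]
  have : (2 * ((M + j : ℕ) : ℝ) + 1) ≠ 0 := by positivity
  field_simp

theorem legendreK_ne_zero (M j : ℕ) : legendreK M j ≠ 0 := fun h => by
  simpa [h] using legendreK_sq_mul M j

/-- The smooth extension of `legendreQ (M + j) M` from `[0, π]` to the real line. -/
def smoothQ (M j : ℕ) (θ : ℝ) : ℝ := legendreK M j * trigPoly M (legendreW M (M + j)) θ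

/-- `M · smoothQ M j / sin`, extended to a smooth function. -/
def smoothR (M j : ℕ) (θ : ℝ) : ℝ :=
  M * (legendreK M j * trigPoly (M - 1) (legendreW M (M + j)) θ)

theorem legendreQ_eq_smoothQ (m : ℤ) (j : ℕ) {θ : ℝ} (hθ : θ ∈ Icc 0 Real.pi) :
    legendreQ (m.natAbs + j) m θ = smoothQ m.natAbs j θ := by
  have hs : √(1 - Real.cos θ ^ 2) = Real.sin θ := by
    rw [← Real.sin_sq, Real.sqrt_sq (Real.sin_nonneg_of_mem_Icc hθ)]
  rw [legendreQ, legendreP, hs, smoothQ, legendreK, trigPoly, legendreW, Nat.add_sub_cancel_left]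
  ring

theorem contDiff_smoothQ (M j : ℕ) {N : WithTop ℕ∞} : ContDiff ℝ N (smoothQ M j) :=
  contDiff_const.mul (contDiff_trigPoly _ _)

theorem contDiff_smoothR (M j : ℕ) {N : WithTop ℕ∞} : ContDiff ℝ N (smoothR M j) :=
  contDiff_const.mul (contDiff_const.mul (contDiff_trigPoly _ _))

theorem smoothR_mul_sin (M j : ℕ) (θ : ℝ) :
    smoothR M j θ * Real.sin θ = M * smoothQ M j θ := by
  rcases M with _ | M
  · simp [smoothR]
  · simp only [smoothR, smoothQ, trigPoly, Nat.add_sub_cancel, pow_succ]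
    ring

theorem sin_mul_deriv_smoothQ (M j : ℕ) (θ : ℝ) :
    Real.sin θ * deriv (smoothQ M j) θ =
      legendreK M j * (M * trigPoly M (Polynomial.X * legendreW M (M + j)) θ -
        trigPoly (M + 2) (Polynomial.derivative (legendreW M (M + j))) θ) := by
  have h : deriv (smoothQ M j) θ = _ := ((hasDerivAt_trigPoly M _ θ).const_mul _).deriv
  rw [h]
  rcases M with _ | M
  · simp [trigPoly]; ring
  · simp only [trigPoly, Nat.add_sub_cancel, Polynomial.eval_mul, Polynomial.eval_X]
    ring

/-- The eigenvalue `n (n + 1)`, `n = M + j`. -/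
def eigen (M j : ℕ) : ℝ := ((M : ℝ) + j) * (M + j + 1)

theorem eigen_nonneg (M j : ℕ) : 0 ≤ eigen M j := by unfold eigen; positivity

/-- The associated Legendre equation. -/
theorem hasDerivAt_sin_mul_deriv_smoothQ (M j : ℕ) (θ : ℝ) :
    HasDerivAt (fun θ => Real.sin θ * deriv (smoothQ M j) θ)
      (M * smoothR M j θ - eigen M j * (Real.sin θ * smoothQ M j θ)) θ := by
  rw [funext (sin_mul_deriv_smoothQ M j)]
  refine ((((hasDerivAt_trigPoly M _ θ).const_mul (M : ℝ)).sub
    (hasDerivAt_trigPoly (M + 2) _ θ)).const_mul (legendreK M j)).congr_deriv ?_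
  have ode := legendreW_ode M (M + j) (Real.cos θ)
  have hs : Real.sin θ ^ 2 = 1 - Real.cos θ ^ 2 := Real.sin_sq θ
  rw [← hs] at ode
  have hs' : Real.cos θ ^ 2 = 1 - Real.sin θ ^ 2 := Real.cos_sq' θ
  simp only [smoothR, smoothQ, trigPoly, eigen, Polynomial.derivative_mul, Polynomial.eval_add,
    Polynomial.eval_mul, Polynomial.eval_X, Polynomial.derivative_X, Polynomial.eval_one]
  rcases M with _ | M
  · simp only [Nat.cast_zero, zero_add, zero_mul, mul_zero, pow_succ, pow_zero] at ode ⊢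
    push_cast at ode ⊢
    linear_combination (legendreK 0 j) * Real.sin θ * ode
  · rw [show M + 1 + 2 - 1 = M + 2 by omega, Nat.add_sub_cancel]
    push_cast at ode ⊢
    linear_combination (legendreK (M + 1) j) * Real.sin θ ^ (M + 2) * ode +
      legendreK (M + 1) j * (M + 1) ^ 2 * Real.sin θ ^ M *
        (legendreW (M + 1) (M + 1 + j)).eval (Real.cos θ) * hs'

/-! ### Cutoff functions and integration by parts up to the poles -/

/-- Lebesgue measure on `(0, π)`. -/
abbrev arc : Measure ℝ := volume.restrict (Ioo 0 Real.pi)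

theorem deriv_smoothTransition_eq_zero {x : ℝ} (h : x < 0 ∨ 1 < x) :
    deriv Real.smoothTransition x = 0 := by
  rcases h with h | h
  · have : Real.smoothTransition =ᶠ[nhds x] fun _ => 0 := by
      filter_upwards [Iio_mem_nhds h] with y hy
      exact Real.smoothTransition.zero_of_nonpos (le_of_lt hy)
    rw [this.deriv_eq, deriv_const]
  · have : Real.smoothTransition =ᶠ[nhds x] fun _ => 1 := by
      filter_upwards [Ioi_mem_nhds h] with y hy
      exact Real.smoothTransition.one_of_one_le (le_of_lt hy)
    rw [this.deriv_eq, deriv_const]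

theorem exists_deriv_smoothTransition_bound :
    ∃ C, 0 ≤ C ∧ ∀ x, |deriv Real.smoothTransition x| ≤ C := by
  have hc : Continuous (deriv Real.smoothTransition) :=
    (Real.smoothTransition.contDiff (n := 1)).continuous_deriv le_rfl
  obtain ⟨C, hC⟩ := isCompact_Icc.exists_bound_of_continuousOn (s := Icc (0 : ℝ) 1) hc.continuousOn
  refine ⟨C, (norm_nonneg _).trans (hC 0 (by simp)), fun x => ?_⟩
  by_cases hx : x ∈ Icc (0 : ℝ) 1
  · exact hC x hx
  · rw [deriv_smoothTransition_eq_zero, abs_zero]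
    · exact (norm_nonneg _).trans (hC 0 (by simp))
    · by_contra! h
      exact hx h

/-- Smooth cutoff functions with compact support in `(0, π)`, increasing to `1`. -/
def cutoff (k : ℕ) (θ : ℝ) : ℝ :=
  Real.smoothTransition (k * θ - 1) * Real.smoothTransition (k * (Real.pi - θ) - 1)

theorem contDiff_cutoff (k : ℕ) {N : ℕ∞} : ContDiff ℝ N (cutoff k) := by
  unfold cutoff
  exact (Real.smoothTransition.contDiff.comp (by fun_prop)).mul
    (Real.smoothTransition.contDiff.comp (by fun_prop))

theorem cutoff_nonneg (k : ℕ) (θ : ℝ) : 0 ≤ cutoff k θ :=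
  mul_nonneg (Real.smoothTransition.nonneg _) (Real.smoothTransition.nonneg _)

theorem cutoff_le_one (k : ℕ) (θ : ℝ) : cutoff k θ ≤ 1 :=
  mul_le_one₀ (Real.smoothTransition.le_one _) (Real.smoothTransition.nonneg _)
    (Real.smoothTransition.le_one _)

theorem tsupport_cutoff_subset (k : ℕ) :
    tsupport (cutoff (k + 1)) ⊆ Icc (1 / ((k + 1 : ℕ) : ℝ)) (Real.pi - 1 / ((k + 1 : ℕ) : ℝ)) := by
  refine closure_minimal (fun θ hθ => ?_) isClosed_Icc
  have hk : (0 : ℝ) < ((k + 1 : ℕ) : ℝ) := by positivity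
  simp only [cutoff, Function.mem_support, ne_eq, mul_eq_zero, not_or,
    Real.smoothTransition.zero_iff_nonpos, not_le] at hθ
  constructor
  · rw [div_le_iff₀ hk]; linarith
  · rw [le_sub_comm, div_le_iff₀ hk]; linarith

theorem hasDerivAt_cutoff (k : ℕ) (θ : ℝ) :
    HasDerivAt (cutoff k)
      (k * deriv Real.smoothTransition (k * θ - 1) *
          Real.smoothTransition (k * (Real.pi - θ) - 1) -
        Real.smoothTransition (k * θ - 1) *
          (k * deriv Real.smoothTransition (k * (Real.pi - θ) - 1))) θ := by
  have hd : ∀ x, HasDerivAt Real.smoothTransition (deriv Real.smoothTransition x) x := fun x =>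
    ((Real.smoothTransition.contDiff (n := 1)).differentiable one_ne_zero x).hasDerivAt
  have h1 : HasDerivAt (fun θ : ℝ => k * θ - 1) (k : ℝ) θ := by
    simpa using ((hasDerivAt_id θ).const_mul (k : ℝ)).sub_const 1
  have h2 : HasDerivAt (fun θ : ℝ => k * (Real.pi - θ) - 1) (-(k : ℝ)) θ := by
    simpa using (((hasDerivAt_id θ).const_sub Real.pi).const_mul (k : ℝ)).sub_const 1
  refine (((hd _).comp θ h1).mul ((hd _).comp θ h2)).congr_deriv ?_
  simp only [Function.comp]
  ring

/-- The derivative has size k, but only at distance at most 2 / k from a pole, and sin is at most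
that distance. The bound is thus uniform in k. -/
theorem exists_deriv_cutoff_bound :
    ∃ C, 0 ≤ C ∧ ∀ k, ∀ θ ∈ Ioo 0 Real.pi, |deriv (cutoff k) θ| ≤ C / Real.sin θ := by
  obtain ⟨C, hC0, hC⟩ := exists_deriv_smoothTransition_bound
  have key : ∀ k : ℕ, ∀ t s : ℝ, 0 < s → s ≤ t →
      |k * deriv Real.smoothTransition (k * t - 1)| ≤ 2 * C / s := by
    intro k t s hs hst
    rw [le_div_iff₀ hs, abs_mul, Nat.abs_cast]
    by_cases h : 1 < k * t - 1
    · rw [deriv_smoothTransition_eq_zero (Or.inr h)]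
      simp [hC0]
    · have h1 : k * s ≤ 2 := by
        have : (k : ℝ) * s ≤ k * t := by gcongr
        linarith
      calc (k : ℝ) * |deriv Real.smoothTransition (k * t - 1)| * s
          = (k * s) * |deriv Real.smoothTransition (k * t - 1)| := by ring
        _ ≤ 2 * C := by gcongr; exact hC _
  refine ⟨2 * C + 2 * C, by positivity, fun k θ hθ => ?_⟩
  have hs := Real.sin_pos_of_mem_Ioo hθ
  have hs1 : Real.sin θ ≤ θ := Real.sin_le hθ.1.le
  have hs2 : Real.sin θ ≤ Real.pi - θ := by
    rw [← Real.sin_pi_sub]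
    exact Real.sin_le (by linarith [hθ.2])
  rw [(hasDerivAt_cutoff k θ).deriv, add_div]
  refine (abs_sub _ _).trans (add_le_add ?_ ?_)
  · rw [abs_mul, abs_of_nonneg (Real.smoothTransition.nonneg (k * (Real.pi - θ) - 1))]
    exact (mul_le_of_le_one_right (abs_nonneg _) (Real.smoothTransition.le_one _)).trans
      (key k θ _ hs hs1)
  · rw [abs_mul, abs_of_nonneg (Real.smoothTransition.nonneg (k * θ - 1))]
    exact (mul_le_of_le_one_left (abs_nonneg _) (Real.smoothTransition.le_one _)).trans
      (key k _ _ hs hs2)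

theorem eventually_cutoff {θ : ℝ} (hθ : θ ∈ Ioo 0 Real.pi) :
    ∀ᶠ k in Filter.atTop, cutoff k θ = 1 ∧ deriv (cutoff k) θ = 0 := by
  have key : ∀ t : ℝ, 0 < t → ∀ᶠ k : ℕ in Filter.atTop, 1 < (k : ℝ) * t - 1 := by
    intro t ht
    have : Filter.Tendsto (fun k : ℕ => (k : ℝ) * t) Filter.atTop Filter.atTop :=
      tendsto_natCast_atTop_atTop.atTop_mul_const ht
    filter_upwards [this.eventually_gt_atTop 2] with k hk
    linarith
  filter_upwards [key θ hθ.1, key (Real.pi - θ) (by linarith [hθ.2])] with k h1 h2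
  constructor
  · rw [cutoff, Real.smoothTransition.one_of_one_le h1.le,
      Real.smoothTransition.one_of_one_le h2.le, one_mul]
  · rw [(hasDerivAt_cutoff k θ).deriv, deriv_smoothTransition_eq_zero (Or.inr h1),
      deriv_smoothTransition_eq_zero (Or.inr h2)]
    simp

theorem ae_arc_mem : ∀ᵐ θ ∂arc, θ ∈ Ioo 0 Real.pi := ae_restrict_mem measurableSet_Ioo

/-- Integration by parts against smooth functions that are not compactly supported. -/
theorem HasWeakDeriv.integral_mul_eq {f g : ℝ → ℂ} (h : HasWeakDeriv f g) {φ : ℝ → ℝ}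
    (hφ : ContDiff ℝ (⊤ : ℕ∞) φ)
    (h1 : Integrable (fun θ => ((φ θ / Real.sin θ : ℝ) : ℂ) * f θ) arc)
    (h2 : Integrable (fun θ => ((deriv φ θ : ℝ) : ℂ) * f θ) arc)
    (h3 : Integrable (fun θ => (φ θ : ℂ) * g θ) arc) :
    ∫ θ, (φ θ : ℂ) * g θ ∂arc = - ∫ θ, ((deriv φ θ : ℝ) : ℂ) * f θ ∂arc := by
  obtain ⟨C, hC0, hC⟩ := exists_deriv_cutoff_bound
  have hfm : AEStronglyMeasurable f arc := h.1.aestronglyMeasurable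
  have hgm : AEStronglyMeasurable g arc := h.2.1.aestronglyMeasurable
  have hφ' : Continuous (deriv φ) := hφ.continuous_deriv (by simp)
  have hχ' : ∀ k, Continuous (deriv (cutoff k)) := fun k =>
    (contDiff_cutoff k (N := 1)).continuous_deriv le_rfl
  have hd : ∀ k θ, deriv (fun θ => cutoff k θ * φ θ) θ =
      deriv (cutoff k) θ * φ θ + cutoff k θ * deriv φ θ := fun k θ =>
    deriv_fun_mul ((contDiff_cutoff k (N := 1)).differentiable one_ne_zero θ)
      (hφ.differentiable (by simp) θ)
  -- The shift to k + 1 keeps the support at the positive distance 1 / (k + 1) from the poles.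
  have key : ∀ k, ∫ θ, ((deriv (fun θ => cutoff (k + 1) θ * φ θ) θ : ℝ) : ℂ) * f θ ∂arc =
      - ∫ θ, ((cutoff (k + 1) θ * φ θ : ℝ) : ℂ) * g θ ∂arc := by
    intro k
    have hk : (0 : ℝ) < 1 / ((k + 1 : ℕ) : ℝ) := by positivity
    refine h.2.2 _ ((contDiff_cutoff _).mul hφ) ?_ ?_
    · refine HasCompactSupport.mul_right (HasCompactSupport.of_support_subset_isCompact
        (K := Icc (1 / ((k + 1 : ℕ) : ℝ)) (Real.pi - 1 / ((k + 1 : ℕ) : ℝ))) isCompact_Icc ?_)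
      exact (subset_tsupport _).trans (tsupport_cutoff_subset k)
    · refine (closure_mono (Function.support_mul_subset_left _ _)).trans
        ((tsupport_cutoff_subset k).trans fun θ hθ => ⟨?_, ?_⟩)
      · linarith [hθ.1]
      · linarith [hθ.2]
  have L1 : Filter.Tendsto (fun k => ∫ θ, ((cutoff (k + 1) θ * φ θ : ℝ) : ℂ) * g θ ∂arc)
      Filter.atTop (nhds (∫ θ, (φ θ : ℂ) * g θ ∂arc)) := by
    refine tendsto_integral_of_dominated_convergence (fun θ => ‖(φ θ : ℂ) * g θ‖) (fun k => ?_)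
      h3.norm (fun k => ?_) ?_
    · have := ((contDiff_cutoff (k + 1) (N := 0)).continuous.mul hφ.continuous)
      exact (Complex.continuous_ofReal.comp this).aestronglyMeasurable.mul hgm
    · refine Filter.Eventually.of_forall fun θ => ?_
      rw [Complex.ofReal_mul, mul_assoc, norm_mul]
      refine mul_le_of_le_one_left (norm_nonneg _) ?_
      rw [Complex.norm_real, Real.norm_of_nonneg (cutoff_nonneg _ _)]
      exact cutoff_le_one _ _
    · filter_upwards [ae_arc_mem] with θ hθ
      refine tendsto_const_nhds.congr' ?_
      filter_upwards [(Filter.tendsto_add_atTop_nat 1).eventually (eventually_cutoff hθ)] with k hk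
      rw [hk.1, one_mul]
  have L2 : Filter.Tendsto
      (fun k => ∫ θ, ((deriv (fun θ => cutoff (k + 1) θ * φ θ) θ : ℝ) : ℂ) * f θ ∂arc)
      Filter.atTop (nhds (∫ θ, ((deriv φ θ : ℝ) : ℂ) * f θ ∂arc)) := by
    -- The term with the derivative of the cutoff is at most C |φ f| / sin, integrable by `h1`, and
    -- tends to 0 pointwise: no boundary term survives.
    refine tendsto_integral_of_dominated_convergence
      (fun θ => C * ‖((φ θ / Real.sin θ : ℝ) : ℂ) * f θ‖ + ‖((deriv φ θ : ℝ) : ℂ) * f θ‖)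
      (fun k => ?_) ((h1.norm.const_mul C).add h2.norm) (fun k => ?_) ?_
    · simp only [hd]
      have := ((hχ' (k + 1)).mul hφ.continuous).add
        ((contDiff_cutoff (k + 1) (N := 0)).continuous.mul hφ')
      exact (Complex.continuous_ofReal.comp this).aestronglyMeasurable.mul hfm
    · filter_upwards [ae_arc_mem] with θ hθ
      have hs := Real.sin_pos_of_mem_Ioo hθ
      rw [hd, Complex.ofReal_add, add_mul]
      refine (norm_add_le _ _).trans (add_le_add ?_ ?_)
      · rw [norm_mul, norm_mul, Complex.norm_real, Complex.norm_real, Real.norm_eq_abs,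
          Real.norm_eq_abs, ← mul_assoc, abs_mul, abs_div, abs_of_pos hs]
        calc |deriv (cutoff (k + 1)) θ| * |φ θ| * ‖f θ‖ ≤ C / Real.sin θ * |φ θ| * ‖f θ‖ := by
              gcongr; exact hC _ _ hθ
          _ = C * (|φ θ| / Real.sin θ) * ‖f θ‖ := by ring
      · rw [Complex.ofReal_mul, mul_assoc, norm_mul]
        refine mul_le_of_le_one_left (norm_nonneg _) ?_
        rw [Complex.norm_real, Real.norm_of_nonneg (cutoff_nonneg _ _)]
        exact cutoff_le_one _ _
    · filter_upwards [ae_arc_mem] with θ hθ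
      refine tendsto_const_nhds.congr' ?_
      filter_upwards [(Filter.tendsto_add_atTop_nat 1).eventually (eventually_cutoff hθ)] with k hk
      rw [hd, hk.1, hk.2, one_mul, zero_mul, zero_add]
  have := tendsto_nhds_unique L2 ((L1.neg).congr fun k => (key k).symm)
  rw [this, neg_neg]

/-- A smooth function has its classical derivative as weak derivative. -/
theorem hasWeakDeriv_ofReal {u : ℝ → ℝ} (hu : ContDiff ℝ 1 u) :
    HasWeakDeriv (fun θ => (u θ : ℂ)) (fun θ => ((deriv u θ : ℝ) : ℂ)) := by
  have hu' : Continuous (deriv u) := hu.continuous_deriv le_rfl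
  have hc : Continuous fun θ => (u θ : ℂ) := Complex.continuous_ofReal.comp hu.continuous
  have hc' : Continuous fun θ => ((deriv u θ : ℝ) : ℂ) := Complex.continuous_ofReal.comp hu'
  refine ⟨hc.locallyIntegrable.locallyIntegrableOn _, hc'.locallyIntegrable.locallyIntegrableOn _,
    fun η hη hηc hηs => ?_⟩
  have hη' : Continuous (deriv η) := hη.continuous_deriv (by simp)
  have hsub : ∀ θ, θ ∉ Ioo 0 Real.pi → η θ = 0 := fun θ hθ =>
    image_eq_zero_of_notMem_tsupport fun h => hθ (hηs h)
  have hsub' : ∀ θ, θ ∉ Ioo 0 Real.pi → deriv η θ = 0 := fun θ hθ =>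
    image_eq_zero_of_notMem_tsupport fun h => hθ (hηs (tsupport_deriv_subset h))
  rw [setIntegral_eq_integral_of_forall_compl_eq_zero (fun θ hθ => by simp [hsub' θ hθ]),
    setIntegral_eq_integral_of_forall_compl_eq_zero (fun θ hθ => by simp [hsub θ hθ])]
  have := integral_mul_deriv_eq_deriv_mul_of_integrable (u := u) (v := η) (u' := deriv u)
    (v' := deriv η) (fun x _ => (hu.differentiable one_ne_zero x).hasDerivAt)
    (fun x _ => (hη.differentiable (by simp) x).hasDerivAt)
    ((hu.continuous.mul hη').integrable_of_hasCompactSupport hηc.deriv.mul_left)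
    ((hu'.mul hη.continuous).integrable_of_hasCompactSupport hηc.mul_left)
    ((hu.continuous.mul hη.continuous).integrable_of_hasCompactSupport hηc.mul_left)
  simp only [← Complex.ofReal_mul, integral_complex_ofReal, ← Complex.ofReal_neg]
  simp only [mul_comm (deriv η _), mul_comm (η _), this]

/-! ### Weighted square integrability -/

/-- Square integrability on `(0, π)` with respect to the weight `sin^k`. -/
def SqInt (k : ℤ) (f : ℝ → ℂ) : Prop :=
  MemLp (fun θ => ((√(Real.sin θ) ^ k : ℝ) : ℂ) * f θ) 2 arc

theorem sqrt_sin_pos {θ : ℝ} (hθ : θ ∈ Ioo 0 Real.pi) : 0 < √(Real.sin θ) :=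
  Real.sqrt_pos.2 (Real.sin_pos_of_mem_Ioo hθ)

theorem sqrt_sin_le_one (θ : ℝ) : √(Real.sin θ) ≤ 1 :=
  Real.sqrt_le_one.2 (Real.sin_le_one θ)

theorem measurable_sqrt_sin_zpow (k : ℤ) : Measurable fun θ : ℝ => √(Real.sin θ) ^ k :=
  Real.measurable_sin.sqrt.pow_const k

theorem sqrt_sin_zpow_sq (k : ℤ) {θ : ℝ} (hθ : θ ∈ Ioo 0 Real.pi) :
    (√(Real.sin θ) ^ k) ^ 2 = Real.sin θ ^ k := by
  rw [← zpow_natCast, ← zpow_mul, mul_comm, zpow_mul, zpow_natCast,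
    Real.sq_sqrt (Real.sin_pos_of_mem_Ioo hθ).le]

theorem exists_bound_arc {u : ℝ → ℝ} (hu : Continuous u) :
    ∃ C, 0 ≤ C ∧ ∀ θ ∈ Ioo 0 Real.pi, |u θ| ≤ C := by
  obtain ⟨C, hC⟩ := isCompact_Icc.exists_bound_of_continuousOn (s := Icc (0 : ℝ) Real.pi)
    hu.continuousOn
  exact ⟨C, (norm_nonneg _).trans (hC 0 ⟨le_rfl, Real.pi_pos.le⟩),
    fun θ hθ => hC θ (Ioo_subset_Icc_self hθ)⟩

theorem sinInt_eq_eLpNorm (k : ℤ) (f : ℝ → ℂ) :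
    sinInt k f = eLpNorm (fun θ => ((√(Real.sin θ) ^ k : ℝ) : ℂ) * f θ) 2 arc ^ 2 := by
  rw [eLpNorm_eq_lintegral_rpow_enorm_toReal two_ne_zero ENNReal.ofNat_ne_top, ← ENNReal.rpow_natCast,
    ← ENNReal.rpow_mul]
  simp only [ENNReal.toReal_ofNat, Nat.cast_ofNat, one_div, inv_mul_cancel₀ (two_ne_zero' ℝ),
    ENNReal.rpow_one]
  refine lintegral_congr_ae ?_
  filter_upwards [ae_arc_mem] with θ hθ
  rw [show (2 : ℝ) = ((2 : ℕ) : ℝ) by norm_num, ENNReal.rpow_natCast, enorm_mul, mul_pow, mul_comm,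
    ← sqrt_sin_zpow_sq k hθ, ENNReal.ofReal_pow (zpow_nonneg (Real.sqrt_nonneg _) _),
    ← ofReal_norm (((√(Real.sin θ) ^ k : ℝ) : ℂ)), Complex.norm_real,
    Real.norm_of_nonneg (zpow_nonneg (Real.sqrt_nonneg _) _)]

theorem sqInt_of_sinInt_ne_top {k : ℤ} {f : ℝ → ℂ} (hf : AEStronglyMeasurable f arc)
    (h : sinInt k f ≠ ⊤) : SqInt k f := by
  refine ⟨(Complex.measurable_ofReal.comp
    (measurable_sqrt_sin_zpow k)).aestronglyMeasurable.mul hf, ?_⟩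
  rw [sinInt_eq_eLpNorm] at h
  exact lt_top_iff_ne_top.2 fun h' => h (by rw [h']; simp)

theorem SqInt.sinInt_ne_top {k : ℤ} {f : ℝ → ℂ} (h : SqInt k f) : sinInt k f ≠ ⊤ := by
  rw [sinInt_eq_eLpNorm]
  exact ENNReal.pow_ne_top h.2.ne

theorem sqInt_of_bound {k : ℤ} {u : ℝ → ℝ} (hu : Continuous u) {C : ℝ}
    (h : ∀ θ ∈ Ioo 0 Real.pi, |u θ| ≤ C * √(Real.sin θ) ^ (-k)) : SqInt k (fun θ => (u θ : ℂ)) := by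
  refine MemLp.of_bound ((Complex.measurable_ofReal.comp
    (measurable_sqrt_sin_zpow k)).aestronglyMeasurable.mul
    (Complex.continuous_ofReal.comp hu).aestronglyMeasurable) C ?_
  filter_upwards [ae_arc_mem] with θ hθ
  have hs : 0 < √(Real.sin θ) ^ k := zpow_pos (sqrt_sin_pos hθ) _
  rw [norm_mul, Complex.norm_real, Complex.norm_real, Real.norm_eq_abs, Real.norm_eq_abs,
    abs_of_pos hs, mul_comm, ← le_div_iff₀ hs]
  simpa [zpow_neg, div_eq_mul_inv] using h θ hθ

theorem sqInt_one_of_continuous {u : ℝ → ℝ} (hu : Continuous u) :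
    SqInt 1 (fun θ => (u θ : ℂ)) := by
  obtain ⟨C, hC0, hC⟩ := exists_bound_arc hu
  refine sqInt_of_bound hu (C := C) fun θ hθ => (hC θ hθ).trans ?_
  refine le_mul_of_one_le_right hC0 ?_
  rw [zpow_neg, zpow_one]
  exact (one_le_inv₀ (sqrt_sin_pos hθ)).2 (sqrt_sin_le_one θ)

theorem SqInt.integrable_mul {k : ℤ} {f : ℝ → ℂ} (hf : SqInt k f) {u : ℝ → ℝ} (hu : Measurable u)
    {C : ℝ} (h : ∀ θ ∈ Ioo 0 Real.pi, |u θ| ≤ C * √(Real.sin θ) ^ k) :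
    Integrable (fun θ => (u θ : ℂ) * f θ) arc := by
  have h1 : Integrable (fun θ => ((√(Real.sin θ) ^ k : ℝ) : ℂ) * f θ) arc :=
    MemLp.integrable (by norm_num) hf
  refine (h1.bdd_mul (c := C) (f := fun θ => ((u θ / √(Real.sin θ) ^ k : ℝ) : ℂ))
    (Complex.measurable_ofReal.comp
      (hu.div (measurable_sqrt_sin_zpow k))).aestronglyMeasurable ?_).congr ?_
  · filter_upwards [ae_arc_mem] with θ hθ
    have hs : 0 < √(Real.sin θ) ^ k := zpow_pos (sqrt_sin_pos hθ) _
    rw [Complex.norm_real, Real.norm_eq_abs, abs_div, abs_of_pos hs, div_le_iff₀ hs]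
    exact h θ hθ
  · filter_upwards [ae_arc_mem] with θ hθ
    have hs : √(Real.sin θ) ^ k ≠ 0 := (zpow_pos (sqrt_sin_pos hθ) _).ne'
    rw [← mul_assoc, ← Complex.ofReal_mul, div_mul_cancel₀ _ hs]

theorem SqInt.integrable_sin_mul {f : ℝ → ℂ} (hf : SqInt 1 f) {u : ℝ → ℝ} (hu : Continuous u) :
    Integrable (fun θ => ((Real.sin θ * u θ : ℝ) : ℂ) * f θ) arc := by
  obtain ⟨C, hC0, hC⟩ := exists_bound_arc hu
  refine hf.integrable_mul (C := C) (by fun_prop) fun θ hθ => ?_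
  have hs := sqrt_sin_pos hθ
  rw [abs_mul, abs_of_pos (Real.sin_pos_of_mem_Ioo hθ), zpow_one, mul_comm]
  refine mul_le_mul (hC θ hθ) ?_ (Real.sin_pos_of_mem_Ioo hθ).le hC0
  nth_rewrite 1 [← Real.sq_sqrt (Real.sin_pos_of_mem_Ioo hθ).le, sq]
  exact mul_le_of_le_one_right hs.le (sqrt_sin_le_one θ)

theorem SqInt.integrable_mul_of_neg {k : ℕ} {f : ℝ → ℂ} (hf : SqInt (-k) f) {u : ℝ → ℝ}
    (hu : Continuous u) : Integrable (fun θ => (u θ : ℂ) * f θ) arc := by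
  obtain ⟨C, hC0, hC⟩ := exists_bound_arc hu
  refine hf.integrable_mul (C := C) hu.measurable fun θ hθ => (hC θ hθ).trans ?_
  refine le_mul_of_one_le_right hC0 ?_
  rw [zpow_neg, zpow_natCast]
  exact (one_le_inv₀ (pow_pos (sqrt_sin_pos hθ) _)).2
    (pow_le_one₀ (sqrt_sin_pos hθ).le (sqrt_sin_le_one θ))

/-! ### Weak eigenvalue equation and orthogonality -/

theorem contDiff_deriv_smoothQ (M j : ℕ) {N : ℕ∞} : ContDiff ℝ N (deriv (smoothQ M j)) :=
  (contDiff_succ_iff_deriv.1 (contDiff_smoothQ M j (N := N + 1))).2.2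

theorem deriv_smoothQ_zero (j : ℕ) (θ : ℝ) : deriv (smoothQ 0 j) θ =
    Real.sin θ * (-(legendreK 0 j * (Polynomial.derivative (legendreW 0 (0 + j))).eval
      (Real.cos θ))) := by
  have h : deriv (smoothQ 0 j) θ = _ := ((hasDerivAt_trigPoly 0 _ θ).const_mul _).deriv
  rw [h]
  simp
  ring

/-- The eigenvalue equation in weak form. -/
theorem HasWeakDeriv.form_eq {M : ℕ} (j : ℕ) {f g : ℝ → ℂ} (h : HasWeakDeriv f g)
    (hf : SqInt 1 f) (hM : M ≠ 0 → SqInt (-1) f) (hg : SqInt 1 g) :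
    ∫ θ, ((Real.sin θ * deriv (smoothQ M j) θ : ℝ) : ℂ) * g θ ∂arc +
      M * ∫ θ, (smoothR M j θ : ℂ) * f θ ∂arc =
    eigen M j * ∫ θ, ((Real.sin θ * smoothQ M j θ : ℝ) : ℂ) * f θ ∂arc := by
  have hq : Continuous (smoothQ M j) := (contDiff_smoothQ M j (N := 0)).continuous
  have hq' : Continuous (deriv (smoothQ M j)) := (contDiff_deriv_smoothQ M j (N := 0)).continuous
  have hr : Continuous (smoothR M j) := (contDiff_smoothR M j (N := 0)).continuous
  have hd : deriv (fun θ => Real.sin θ * deriv (smoothQ M j) θ) = fun θ =>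
      M * smoothR M j θ - eigen M j * (Real.sin θ * smoothQ M j θ) :=
    funext fun θ => (hasDerivAt_sin_mul_deriv_smoothQ M j θ).deriv
  -- For M = 0 nothing is known about f / sin, but q' itself then carries a factor sin.
  have i1 : Integrable (fun θ => ((deriv (smoothQ M j) θ : ℝ) : ℂ) * f θ) arc := by
    rcases Nat.eq_zero_or_pos M with rfl | hM'
    · simp only [deriv_smoothQ_zero]
      refine hf.integrable_sin_mul ?_
      have := (Polynomial.derivative (legendreW 0 (0 + j))).continuous.comp Real.continuous_cos
      simp only [Function.comp_def] at this
      fun_prop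
    · exact (hM hM'.ne').integrable_mul_of_neg (k := 1) hq'
  have i2 : Integrable (fun θ => (smoothR M j θ : ℂ) * f θ) arc := by
    rcases Nat.eq_zero_or_pos M with rfl | hM'
    · simp [smoothR]
    · exact (hM hM'.ne').integrable_mul_of_neg (k := 1) hr
  have i3 := hf.integrable_sin_mul hq
  have e : ∀ θ, ((M * smoothR M j θ - eigen M j * (Real.sin θ * smoothQ M j θ) : ℝ) : ℂ) * f θ =
      M * ((smoothR M j θ : ℂ) * f θ) -
        eigen M j * (((Real.sin θ * smoothQ M j θ : ℝ) : ℂ) * f θ) := fun θ => by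
    push_cast; ring
  have key := h.integral_mul_eq (φ := fun θ => Real.sin θ * deriv (smoothQ M j) θ)
    (Real.contDiff_sin.mul (contDiff_deriv_smoothQ M j))
    (i1.congr (by
      filter_upwards [ae_arc_mem] with θ hθ
      rw [mul_div_cancel_left₀ _ (Real.sin_pos_of_mem_Ioo hθ).ne']))
    (by
      rw [hd]
      simp only [e]
      exact (i2.const_mul _).sub (i3.const_mul _))
    (hg.integrable_sin_mul hq')
  rw [hd] at key
  simp only [e] at key
  rw [integral_sub (i2.const_mul _) (i3.const_mul _), integral_const_mul, integral_const_mul] at key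
  rw [key]
  ring

theorem sqInt_neg_one_smoothQ {M : ℕ} (hM : M ≠ 0) (j : ℕ) :
    SqInt (-1) (fun θ => (smoothQ M j θ : ℂ)) := by
  obtain ⟨C, hC0, hC⟩ := exists_bound_arc (contDiff_smoothR M j (N := 0)).continuous
  refine sqInt_of_bound (contDiff_smoothQ M j (N := 0)).continuous (C := C) fun θ hθ => ?_
  have hs := Real.sin_pos_of_mem_Ioo hθ
  have h1 : |(M : ℝ) * smoothQ M j θ| ≤ C * √(Real.sin θ) := by
    rw [← smoothR_mul_sin, abs_mul, abs_of_pos hs]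
    refine mul_le_mul (hC θ hθ) ?_ hs.le hC0
    nth_rewrite 1 [← Real.sq_sqrt hs.le, sq]
    exact mul_le_of_le_one_right (Real.sqrt_nonneg _) (sqrt_sin_le_one θ)
  rw [neg_neg, zpow_one]
  refine le_trans ?_ h1
  rw [abs_mul, Nat.abs_cast]
  exact le_mul_of_one_le_left (abs_nonneg _) (by exact_mod_cast Nat.one_le_iff_ne_zero.2 hM)

theorem continuous_smoothQ (M j : ℕ) : Continuous (smoothQ M j) :=
  (contDiff_smoothQ M j (N := 0)).continuous

theorem continuous_smoothR (M j : ℕ) : Continuous (smoothR M j) :=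
  (contDiff_smoothR M j (N := 0)).continuous

theorem continuous_deriv_smoothQ (M j : ℕ) : Continuous (deriv (smoothQ M j)) :=
  (contDiff_deriv_smoothQ M j (N := 0)).continuous

theorem form_eq_smoothQ (M i j : ℕ) :
    ∫ θ, Real.sin θ * deriv (smoothQ M j) θ * deriv (smoothQ M i) θ ∂arc +
      ∫ θ, Real.sin θ * smoothR M j θ * smoothR M i θ ∂arc =
    eigen M j * ∫ θ, Real.sin θ * smoothQ M j θ * smoothQ M i θ ∂arc := by
  have h := (hasWeakDeriv_ofReal (contDiff_smoothQ M i)).form_eq (M := M) j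
    (sqInt_one_of_continuous (continuous_smoothQ M i)) (fun hM => sqInt_neg_one_smoothQ hM i)
    (sqInt_one_of_continuous (continuous_deriv_smoothQ M i))
  have e : ∀ θ, Real.sin θ * smoothR M j θ * smoothR M i θ =
      M * (smoothR M j θ * smoothQ M i θ) := fun θ => by
    linear_combination smoothR M j θ * smoothR_mul_sin M i θ
  simp only [e, integral_const_mul]
  simp only [← Complex.ofReal_mul, integral_complex_ofReal] at h
  exact_mod_cast h

theorem eigen_injective (M : ℕ) : Function.Injective (eigen M) := by
  intro i j h
  have h1 : ((i : ℝ) - j) * (2 * M + i + j + 1) = 0 := by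
    unfold eigen at h
    linear_combination h
  rcases mul_eq_zero.1 h1 with h2 | h2
  · exact_mod_cast sub_eq_zero.1 h2
  · have : (0 : ℝ) < 2 * M + i + j + 1 := by positivity
    linarith

/-- Off the diagonal, the form is symmetric and the eigenvalues are distinct; on it, this is the
normalization `legendreK_sq_mul`. -/
theorem integral_smoothQ_mul (M i j : ℕ) :
    ∫ θ, Real.sin θ * smoothQ M j θ * smoothQ M i θ ∂arc = if j = i then 1 else 0 := by
  split_ifs with hij
  · subst hij
    rw [← integral_Ioc_eq_integral_Ioo, ← intervalIntegral.integral_of_le Real.pi_pos.le,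
      ← legendreK_sq_mul M j, legendreN, ← intervalIntegral.integral_const_mul]
    refine intervalIntegral.integral_congr fun θ _ => ?_
    simp only [smoothQ, trigPoly]
    ring
  · have h1 := form_eq_smoothQ M i j
    have h2 := form_eq_smoothQ M j i
    have hc : ∀ u v : ℝ → ℝ, ∫ θ, Real.sin θ * u θ * v θ ∂arc =
        ∫ θ, Real.sin θ * v θ * u θ ∂arc := fun u v => by
      congr 1; ext θ; ring
    rw [hc (deriv (smoothQ M i)), hc (smoothR M i), hc (smoothQ M i), h1] at h2
    have h3 : (eigen M j - eigen M i) *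
        ∫ θ, Real.sin θ * smoothQ M j θ * smoothQ M i θ ∂arc = 0 := by
      linear_combination h2
    exact (mul_eq_zero.1 h3).resolve_left (sub_ne_zero.2 fun h => hij (eigen_injective M h))

/-! ### Weighted functions in L² and completeness of the Legendre functions -/

/-- The element `√(sin)^k f` of the Hilbert space `L²(0, π)`. -/
def SqInt.toL2 {k : ℤ} {f : ℝ → ℂ} (h : SqInt k f) : Lp ℂ 2 arc := MemLp.toLp _ h

theorem SqInt.coeFn_toL2 {k : ℤ} {f : ℝ → ℂ} (h : SqInt k f) :
    h.toL2 =ᵐ[arc] fun θ => ((√(Real.sin θ) ^ k : ℝ) : ℂ) * f θ := MemLp.coeFn_toLp h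

theorem SqInt.sinInt_eq_enorm {k : ℤ} {f : ℝ → ℂ} (h : SqInt k f) :
    sinInt k f = ‖h.toL2‖ₑ ^ 2 := by
  rw [sinInt_eq_eLpNorm]
  exact congrArg (· ^ 2) (Lp.enorm_toLp (hf := h)).symm

theorem inner_toL2_left {k : ℤ} {u : ℝ → ℝ} (hu : SqInt k (fun θ => (u θ : ℂ)))
    (x : Lp ℂ 2 arc) :
    inner ℂ hu.toL2 x = ∫ θ, ((√(Real.sin θ) ^ k * u θ : ℝ) : ℂ) * x θ ∂arc := by
  rw [L2.inner_def]
  refine integral_congr_ae ?_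
  filter_upwards [hu.coeFn_toL2] with θ hθ
  rw [hθ, RCLike.inner_apply', ← Complex.ofReal_mul, Complex.conj_ofReal]

theorem inner_toL2_one_one {u : ℝ → ℝ} (hu : SqInt 1 (fun θ => (u θ : ℂ))) {g : ℝ → ℂ}
    (hg : SqInt 1 g) :
    inner ℂ hu.toL2 hg.toL2 = ∫ θ, ((Real.sin θ * u θ : ℝ) : ℂ) * g θ ∂arc := by
  rw [inner_toL2_left]
  refine integral_congr_ae ?_
  filter_upwards [hg.coeFn_toL2, ae_arc_mem] with θ hθ hm
  rw [hθ, zpow_one, ← mul_assoc, ← Complex.ofReal_mul]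
  congr 2
  nth_rewrite 3 [← Real.sq_sqrt (Real.sin_pos_of_mem_Ioo hm).le]
  ring

/-- Opposite weights are dual: they cancel in the product, so the unweighted pairing is continuous.
-/
theorem inner_toL2_of_add_eq_zero {k l : ℤ} (hkl : k + l = 0) {u : ℝ → ℝ}
    (hu : SqInt k (fun θ => (u θ : ℂ))) {g : ℝ → ℂ} (hg : SqInt l g) :
    inner ℂ hu.toL2 hg.toL2 = ∫ θ, (u θ : ℂ) * g θ ∂arc := by
  rw [inner_toL2_left]
  refine integral_congr_ae ?_
  filter_upwards [hg.coeFn_toL2, ae_arc_mem] with θ hθ hm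
  rw [hθ, ← mul_assoc, ← Complex.ofReal_mul]
  congr 2
  rw [mul_right_comm, ← zpow_add₀ (sqrt_sin_pos hm).ne', hkl, zpow_zero, one_mul]

theorem sqInt_smoothQ (M j : ℕ) : SqInt 1 (fun θ => (smoothQ M j θ : ℂ)) :=
  sqInt_one_of_continuous (continuous_smoothQ M j)

theorem sqInt_deriv_smoothQ (M j : ℕ) : SqInt 1 (fun θ => ((deriv (smoothQ M j) θ : ℝ) : ℂ)) :=
  sqInt_one_of_continuous (continuous_deriv_smoothQ M j)

theorem sqInt_smoothR (M j : ℕ) : SqInt 1 (fun θ => (smoothR M j θ : ℂ)) :=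
  sqInt_one_of_continuous (continuous_smoothR M j)

/-- The coefficients of `f` with respect to the functions `smoothQ M j`. -/
def legendreCoeff (M j : ℕ) (f : ℝ → ℂ) : ℂ :=
  ∫ θ, ((Real.sin θ * smoothQ M j θ : ℝ) : ℂ) * f θ ∂arc

theorem orthonormal_smoothQ (M : ℕ) : Orthonormal ℂ fun j => (sqInt_smoothQ M j).toL2 := by
  classical
  rw [orthonormal_iff_ite]
  intro i j
  rw [inner_toL2_one_one]
  simp only [← Complex.ofReal_mul, integral_complex_ofReal, integral_smoothQ_mul]
  split_ifs <;> simp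

/-- In the variable x = cos θ, Weierstrass approximation replaces a test function by polynomials,
uniformly on the arc. -/
theorem ae_eq_zero_of_integral_polynomial_cos {F : ℝ → ℂ} (hF : Integrable F arc)
    (h : ∀ p : Polynomial ℝ, ∫ θ, ((p.eval (Real.cos θ) : ℝ) : ℂ) * F θ ∂arc = 0) :
    ∀ᵐ θ ∂arc, F θ = 0 := by
  rw [ae_restrict_iff' measurableSet_Ioo]
  refine isOpen_Ioo.ae_eq_zero_of_integral_contDiff_smul_eq_zero
    (IntegrableOn.locallyIntegrableOn hF) fun η hη hηc hηs => ?_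
  have hη0 : ∀ θ, θ ∉ Ioo 0 Real.pi → η θ = 0 := fun θ hθ =>
    image_eq_zero_of_notMem_tsupport fun h => hθ (hηs h)
  rw [← setIntegral_eq_integral_of_forall_compl_eq_zero (s := Ioo 0 Real.pi)
    (fun θ hθ => by simp [hη0 θ hθ])]
  have hηF : Integrable (fun θ => η θ • F θ) arc := by
    obtain ⟨C, -, hC⟩ := exists_bound_arc hη.continuous
    refine hF.bdd_smul C hη.continuous.aestronglyMeasurable ?_
    filter_upwards [ae_arc_mem] with θ hθ using hC θ hθ
  refine norm_le_zero_iff.1 (le_of_forall_pos_le_add fun ε hε => ?_)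
  set I := ∫ θ, ‖F θ‖ ∂arc with hI
  have hI0 : 0 ≤ I := integral_nonneg fun _ => norm_nonneg _
  -- The denominator I + 1 rather than I covers the case of vanishing I.
  obtain ⟨p, hp⟩ := exists_polynomial_near_of_continuousOn (-1) 1 (fun x => η (Real.arccos x))
    (hη.continuous.comp Real.continuous_arccos).continuousOn (ε / (I + 1)) (by positivity)
  have hpc : Continuous fun θ => p.eval (Real.cos θ) := p.continuous.comp Real.continuous_cos
  have hpF : Integrable (fun θ => ((p.eval (Real.cos θ) : ℝ) : ℂ) * F θ) arc := by
    obtain ⟨C, -, hC⟩ := exists_bound_arc hpc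
    refine hF.bdd_mul (c := C) (Complex.continuous_ofReal.comp hpc).aestronglyMeasurable ?_
    filter_upwards [ae_arc_mem] with θ hθ
    simpa using hC θ hθ
  have e : ∫ θ, η θ • F θ ∂arc = ∫ θ, (η θ • F θ - ((p.eval (Real.cos θ) : ℝ) : ℂ) * F θ) ∂arc := by
    rw [integral_sub hηF hpF, h p, sub_zero]
  rw [e, zero_add]
  calc ‖∫ θ, (η θ • F θ - ((p.eval (Real.cos θ) : ℝ) : ℂ) * F θ) ∂arc‖
      ≤ ∫ θ, ε / (I + 1) * ‖F θ‖ ∂arc := by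
        refine norm_integral_le_of_norm_le (hF.norm.const_mul _) ?_
        filter_upwards [ae_arc_mem] with θ hθ
        rw [Complex.real_smul, ← sub_mul, norm_mul, ← Complex.ofReal_sub, Complex.norm_real,
          Real.norm_eq_abs, abs_sub_comm]
        have := hp (Real.cos θ) ⟨Real.neg_one_le_cos θ, Real.cos_le_one θ⟩
        rw [Real.arccos_cos hθ.1.le hθ.2.le] at this
        gcongr
    _ = ε * (I / (I + 1)) := by rw [integral_const_mul, ← hI]; ring
    _ ≤ ε := mul_le_of_le_one_right hε.le ((div_le_one (by positivity)).2 (by linarith))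

/-- The Legendre polynomials of order `M`, as a sequence of polynomials with one in each degree. -/
def legendreSequence (M : ℕ) : Polynomial.Sequence ℝ where
  elems' j := legendreW M (M + j)
  degree_eq' j := degree_legendreW M j

/-- Absorbing the weight √sin · sin^M into x leaves a function orthogonal to `legendreW M (M + j)`
in cos θ for all j, hence to every polynomial in cos θ. The weight is positive inside the arc. -/
theorem eq_zero_of_inner_smoothQ {M : ℕ} {x : Lp ℂ 2 arc}
    (h : ∀ j, inner ℂ (sqInt_smoothQ M j).toL2 x = 0) : x = 0 := by
  set F : ℝ → ℂ := fun θ => ((√(Real.sin θ) * Real.sin θ ^ M : ℝ) : ℂ) * x θ with hFdef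
  have hx : Integrable x arc := (Lp.memLp x).integrable (by norm_num)
  have hF : Integrable F arc := by
    refine hx.bdd_mul (c := 1) (Complex.continuous_ofReal.comp (by fun_prop)).aestronglyMeasurable ?_
    refine Filter.Eventually.of_forall fun θ => ?_
    rw [Complex.norm_real, norm_mul, norm_pow, Real.norm_of_nonneg (Real.sqrt_nonneg _)]
    exact mul_le_one₀ (sqrt_sin_le_one θ) (by positivity)
      (pow_le_one₀ (norm_nonneg _) (Real.abs_sin_le_one θ))
  have hint : ∀ p : Polynomial ℝ, Integrable (fun θ => ((p.eval (Real.cos θ) : ℝ) : ℂ) * F θ) arc := by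
    intro p
    have hpc : Continuous fun θ => p.eval (Real.cos θ) := p.continuous.comp Real.continuous_cos
    obtain ⟨C, -, hC⟩ := exists_bound_arc hpc
    refine hF.bdd_mul (c := C) (Complex.continuous_ofReal.comp hpc).aestronglyMeasurable ?_
    filter_upwards [ae_arc_mem] with θ hθ
    simpa using hC θ hθ
  have hp : ∀ p : Polynomial ℝ, ∫ θ, ((p.eval (Real.cos θ) : ℝ) : ℂ) * F θ ∂arc = 0 := by
    intro p
    have hmem : p ∈ Submodule.span ℝ (Set.range (legendreSequence M)) := by
      rw [(legendreSequence M).span fun i =>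
        (Polynomial.leadingCoeff_ne_zero.2 ((legendreSequence M).ne_zero i)).isUnit]
      trivial
    induction hmem using Submodule.span_induction with
    | mem p hp =>
      obtain ⟨j, rfl⟩ := hp
      have hj := h j
      rw [inner_toL2_left] at hj
      have e : ∀ θ, ((√(Real.sin θ) ^ (1 : ℤ) * smoothQ M j θ : ℝ) : ℂ) * x θ =
          legendreK M j * (((((legendreSequence M) j).eval (Real.cos θ) : ℝ) : ℂ) * F θ) := fun θ => by
        simp only [zpow_one, smoothQ, trigPoly, hFdef]
        rw [show (legendreSequence M) j = legendreW M (M + j) from rfl]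
        push_cast
        ring
      simp only [e, integral_const_mul] at hj
      exact (mul_eq_zero.1 hj).resolve_left (by exact_mod_cast legendreK_ne_zero M j)
    | zero => simp
    | add p q _ _ hp hq =>
      simp only [Polynomial.eval_add, Complex.ofReal_add, add_mul]
      rw [integral_add (hint p) (hint q), hp, hq, add_zero]
    | smul c p _ hp =>
      simp only [Polynomial.eval_smul, smul_eq_mul, Complex.ofReal_mul, mul_assoc]
      rw [integral_const_mul, hp, mul_zero]
  refine (Lp.eq_zero_iff_ae_eq_zero).2 ?_
  filter_upwards [ae_eq_zero_of_integral_polynomial_cos hF hp, ae_arc_mem] with θ hθ hm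
  refine (mul_eq_zero.1 hθ).resolve_left ?_
  exact_mod_cast (mul_pos (sqrt_sin_pos hm) (pow_pos (Real.sin_pos_of_mem_Ioo hm) M)).ne'

/-- The expansion of `f` in the functions `smoothQ M j`. -/
theorem SqInt.hasSum_smoothQ (M : ℕ) {f : ℝ → ℂ} (hf : SqInt 1 f) :
    HasSum (fun j => legendreCoeff M j f • (sqInt_smoothQ M j).toL2) hf.toL2 := by
  let b := HilbertBasis.mkOfOrthogonalEqBot (orthonormal_smoothQ M) (by
    rw [Submodule.eq_bot_iff]
    intro x hx
    refine eq_zero_of_inner_smoothQ (M := M) fun j => ?_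
    exact (Submodule.mem_orthogonal _ _).1 hx _ (Submodule.subset_span ⟨j, rfl⟩))
  have hb : ⇑b = fun j => (sqInt_smoothQ M j).toL2 := HilbertBasis.coe_mkOfOrthogonalEqBot _ _
  have h := b.hasSum_repr hf.toL2
  simp only [b.repr_apply_apply, hb, inner_toL2_one_one] at h
  exact h

/-! ### Bessel's inequality and the first order upper bound -/

theorem norm_sum_sq_of_orthogonal {E : Type*} [NormedAddCommGroup E] [InnerProductSpace ℂ E]
    {v : ℕ → E} {l : ℕ → ℝ} (hv : ∀ i j, inner ℂ (v i) (v j) = if i = j then (l i : ℂ) else 0)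
    (c : ℕ → ℂ) (s : Finset ℕ) :
    ‖∑ j ∈ s, c j • v j‖ ^ 2 = ∑ j ∈ s, l j * ‖c j‖ ^ 2 := by
  set y := ∑ j ∈ s, c j • v j with hy
  have h2 : inner ℂ y y = ((∑ j ∈ s, l j * ‖c j‖ ^ 2 : ℝ) : ℂ) := by
    nth_rewrite 1 [hy]
    rw [sum_inner]
    push_cast
    refine Finset.sum_congr rfl fun j hj => ?_
    rw [inner_smul_left, hy, inner_sum, Finset.sum_eq_single_of_mem j hj, inner_smul_right, hv,
      if_pos rfl, ← Complex.conj_mul']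
    · ring
    · intro i _ hij
      rw [inner_smul_right, hv, if_neg (Ne.symm hij), mul_zero]
  rw [@inner_self_eq_norm_sq_to_K ℂ] at h2
  exact Complex.ofReal_injective (h2 ▸ Complex.ofReal_pow _ _)

/-- Bessel's inequality for an orthogonal family that need not be normalized. -/
theorem sum_le_norm_sq_of_orthogonal {E : Type*} [NormedAddCommGroup E] [InnerProductSpace ℂ E]
    {v : ℕ → E} {l : ℕ → ℝ} (hv : ∀ i j, inner ℂ (v i) (v j) = if i = j then (l i : ℂ) else 0)
    {x : E} {c : ℕ → ℂ} (hx : ∀ j, inner ℂ (v j) x = l j * c j) (s : Finset ℕ) :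
    ∑ j ∈ s, l j * ‖c j‖ ^ 2 ≤ ‖x‖ ^ 2 := by
  set y := ∑ j ∈ s, c j • v j with hy
  have h1 : inner ℂ y x = ((∑ j ∈ s, l j * ‖c j‖ ^ 2 : ℝ) : ℂ) := by
    rw [hy, sum_inner]
    push_cast
    refine Finset.sum_congr rfl fun j _ => ?_
    rw [inner_smul_left, hx, ← Complex.conj_mul']
    ring
  have h3 := @norm_sub_sq ℂ E _ _ _ x y
  have h4 : ‖y‖ ^ 2 = ∑ j ∈ s, l j * ‖c j‖ ^ 2 := norm_sum_sq_of_orthogonal hv c s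
  have h5 : RCLike.re (inner ℂ x y) = ∑ j ∈ s, l j * ‖c j‖ ^ 2 := by
    rw [inner_re_symm, h1]
    exact Complex.ofReal_re _
  rw [h4, h5] at h3
  nlinarith [sq_nonneg ‖x - y‖]

theorem enorm_sq_eq_ofReal {E : Type*} [SeminormedAddCommGroup E] (x : E) :
    ‖x‖ₑ ^ 2 = ENNReal.ofReal (‖x‖ ^ 2) := by
  rw [← ofReal_norm, ENNReal.ofReal_pow (norm_nonneg _)]

theorem sum_ofReal_mul_enorm_sq {b : ℕ → ℝ} (hb : ∀ j, 0 ≤ b j) (c : ℕ → ℂ) (s : Finset ℕ) :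
    ∑ j ∈ s, ENNReal.ofReal (b j) * ‖c j‖ₑ ^ 2 = ENNReal.ofReal (∑ j ∈ s, b j * ‖c j‖ ^ 2) := by
  rw [ENNReal.ofReal_sum_of_nonneg fun j _ => mul_nonneg (hb j) (sq_nonneg _)]
  exact Finset.sum_congr rfl fun j _ => by rw [enorm_sq_eq_ofReal, ENNReal.ofReal_mul (hb j)]

theorem inner_smoothQ (M i j : ℕ) :
    inner ℂ (sqInt_smoothQ M i).toL2 (sqInt_smoothQ M j).toL2 =
      if i = j then ((1 : ℝ) : ℂ) else 0 := by
  rw [orthonormal_iff_ite.1 (orthonormal_smoothQ M), Complex.ofReal_one]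

/-- The pairs `(q', M q / sin)` for `q = smoothQ M j`, as elements of `L² × L²`. -/
def formVec (M j : ℕ) : WithLp 2 (Lp ℂ 2 arc × Lp ℂ 2 arc) :=
  WithLp.toLp 2 ((sqInt_deriv_smoothQ M j).toL2, (sqInt_smoothR M j).toL2)

theorem inner_formVec (M i j : ℕ) :
    inner ℂ (formVec M i) (formVec M j) = if i = j then (eigen M i : ℂ) else 0 := by
  rw [formVec, formVec, WithLp.prod_inner_apply]
  simp only [inner_toL2_one_one]
  simp only [← Complex.ofReal_mul, integral_complex_ofReal, ← Complex.ofReal_add]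
  rw [form_eq_smoothQ, integral_smoothQ_mul]
  split_ifs <;> simp

/-- Since (n + 1/2)² = 1/4 + n(n + 1), this adds two Bessel inequalities: one for f against the q_j,
one for (f', M f / sin) against `formVec`, whose coefficients come from the weak eigenvalue
equation. -/
theorem tsum_coeff_le_first_order {M : ℕ} {f g : ℝ → ℂ} (h : HasWeakDeriv f g) (hf : SqInt 1 f) :
    ∑' j : ℕ, ENNReal.ofReal (((M : ℝ) + j + 1 / 2) ^ 2) * ‖legendreCoeff M j f‖ₑ ^ 2 ≤
      ENNReal.ofReal (1 / 4) * sinInt 1 f + ENNReal.ofReal ((M : ℝ) ^ 2) * sinInt (-1) f +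
        sinInt 1 g := by
  rcases eq_or_ne (ENNReal.ofReal (1 / 4) * sinInt 1 f +
    ENNReal.ofReal ((M : ℝ) ^ 2) * sinInt (-1) f + sinInt 1 g) ⊤ with htop | htop
  · rw [htop]; exact le_top
  obtain ⟨h12, hg0⟩ := ENNReal.add_ne_top.1 htop
  obtain ⟨-, hm0⟩ := ENNReal.add_ne_top.1 h12
  have hg : SqInt 1 g := sqInt_of_sinInt_ne_top h.2.1.aestronglyMeasurable hg0
  have hM : M ≠ 0 → SqInt (-1) f := fun hM =>
    sqInt_of_sinInt_ne_top h.1.aestronglyMeasurable fun ht => by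
      rw [ht] at hm0
      exact hm0 (ENNReal.mul_top (by simpa using hM))
  -- Here y stands for M f / sin. For M = 0 the integral of |f|² / sin may be infinite, but 0 · ∞ =
  -- 0 and y = 0 serves.
  obtain ⟨y, hy1, hy2⟩ : ∃ y : Lp ℂ 2 arc,
      ENNReal.ofReal ((M : ℝ) ^ 2) * sinInt (-1) f = ‖y‖ₑ ^ 2 ∧
      ∀ j, inner ℂ (sqInt_smoothR M j).toL2 y = M * ∫ θ, (smoothR M j θ : ℂ) * f θ ∂arc := by
    rcases Nat.eq_zero_or_pos M with rfl | hM'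
    · exact ⟨0, by simp, by simp⟩
    · refine ⟨(M : ℂ) • (hM hM'.ne').toL2, ?_, fun j => ?_⟩
      · rw [enorm_smul, mul_pow, ← (hM hM'.ne').sinInt_eq_enorm, enorm_sq_eq_ofReal]
        simp
      · rw [inner_smul_right, inner_toL2_of_add_eq_zero (by norm_num)]
  set x : WithLp 2 (Lp ℂ 2 arc × Lp ℂ 2 arc) := WithLp.toLp 2 (hg.toL2, y) with hx
  have hxj : ∀ j, inner ℂ (formVec M j) x = eigen M j * legendreCoeff M j f := fun j => by
    rw [hx, formVec, WithLp.prod_inner_apply]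
    simp only [inner_toL2_one_one, hy2]
    exact h.form_eq j hf hM hg
  have hxn : ‖x‖ ^ 2 = ‖hg.toL2‖ ^ 2 + ‖y‖ ^ 2 := WithLp.prod_norm_sq_eq_of_L2 x
  have hfj : ∀ j, inner ℂ (sqInt_smoothQ M j).toL2 hf.toL2 =
      ((fun _ => 1 : ℕ → ℝ) j : ℂ) * legendreCoeff M j f := fun j => by
    rw [inner_toL2_one_one, Complex.ofReal_one, one_mul]; rfl
  rw [hy1, hg.sinInt_eq_enorm, hf.sinInt_eq_enorm, enorm_sq_eq_ofReal, enorm_sq_eq_ofReal,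
    enorm_sq_eq_ofReal, ← ENNReal.ofReal_mul (by norm_num), ← ENNReal.ofReal_add (by positivity)
      (by positivity), ← ENNReal.ofReal_add (by positivity) (by positivity),
    ENNReal.tsum_eq_iSup_sum]
  refine iSup_le fun s => ?_
  rw [sum_ofReal_mul_enorm_sq fun j => by positivity]
  refine ENNReal.ofReal_le_ofReal ?_
  have b1 := sum_le_norm_sq_of_orthogonal (inner_formVec M) hxj s
  have b2 := sum_le_norm_sq_of_orthogonal (l := fun _ => 1) (inner_smoothQ M) hfj s
  have e : ∑ j ∈ s, ((M : ℝ) + j + 1 / 2) ^ 2 * ‖legendreCoeff M j f‖ ^ 2 =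
      1 / 4 * ∑ j ∈ s, 1 * ‖legendreCoeff M j f‖ ^ 2 +
        ∑ j ∈ s, eigen M j * ‖legendreCoeff M j f‖ ^ 2 := by
    rw [Finset.mul_sum, ← Finset.sum_add_distrib]
    exact Finset.sum_congr rfl fun j _ => by unfold eigen; ring
  rw [e]
  linarith

/-! ### Second order upper bound -/

theorem weighted_sq_le {s F G H m : ℝ} (hs : 0 < s) (hs1 : s ≤ 1) (hF : 0 ≤ F) (hG : 0 ≤ G)
    (hH : 0 ≤ H) (hm : 2 ≤ m) :
    (H + G / s + (m ^ 2 / s ^ 2 + 1 / 4) * F) ^ 2 * s ≤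
      3 * (m ^ 4 * (F ^ 2 * (s ^ 3)⁻¹) + m ^ 2 * (G ^ 2 * s⁻¹) + H ^ 2 * s) := by
  set A := m ^ 2 * F / s ^ 2 with hA
  set B := G / s with hB
  have hA0 : 0 ≤ A := by positivity
  have hB0 : 0 ≤ B := by positivity
  -- From m ≥ 2 and s ≤ 1 one has A ≥ 4 F, so the term F / 4 costs at most A / 16.
  have h1 : (m ^ 2 / s ^ 2 + 1 / 4) * F ≤ 17 / 16 * A := by
    have : F / 4 ≤ A / 16 := by
      rw [hA, div_div, div_le_div_iff₀ (by norm_num) (by positivity)]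
      have : s ^ 2 ≤ 1 := pow_le_one₀ hs.le hs1
      nlinarith [mul_nonneg hF (sub_nonneg.2 this), mul_nonneg hF (by nlinarith : 0 ≤ m ^ 2 - 4)]
    calc (m ^ 2 / s ^ 2 + 1 / 4) * F = A + F / 4 := by rw [hA]; ring
      _ ≤ _ := by linarith
  have h2 : m ^ 4 * (F ^ 2 * (s ^ 3)⁻¹) = A ^ 2 * s := by
    rw [hA]; field_simp
  have h3 : m ^ 2 * (G ^ 2 * s⁻¹) = m ^ 2 * B ^ 2 * s := by
    rw [hB]; field_simp
  rw [h2, h3]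
  have h4 : (H + B + (m ^ 2 / s ^ 2 + 1 / 4) * F) ^ 2 ≤ (H + B + 17 / 16 * A) ^ 2 := by
    gcongr
  have h5 : (H + B + 17 / 16 * A) ^ 2 ≤ 3 * (A ^ 2 + 4 * B ^ 2 + H ^ 2) := by
    nlinarith [sq_nonneg (H - 4 * B), sq_nonneg (H - A), sq_nonneg (A - 4 * B)]
  have h6 : 4 * B ^ 2 ≤ m ^ 2 * B ^ 2 := by
    gcongr; nlinarith
  calc _ ≤ (3 * (A ^ 2 + m ^ 2 * B ^ 2 + H ^ 2)) * s := by gcongr; linarith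
    _ = _ := by ring

theorem lintegral_arc_const_mul_sinInt (c : ℝ) (k : ℤ) (f : ℝ → ℂ) :
    ENNReal.ofReal c * sinInt k f =
      ∫⁻ θ, ENNReal.ofReal c * (‖f θ‖ₑ ^ 2 * ENNReal.ofReal (Real.sin θ ^ k)) ∂arc :=
  (lintegral_const_mul' _ _ ENNReal.ofReal_ne_top).symm

theorem aemeasurable_sinInt {f : ℝ → ℂ} (hf : AEStronglyMeasurable f arc) (k : ℤ) :
    AEMeasurable (fun θ => ‖f θ‖ₑ ^ 2 * ENNReal.ofReal (Real.sin θ ^ k)) arc :=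
  (hf.enorm.pow_const 2).mul (Real.measurable_sin.pow_const k).ennreal_ofReal.aemeasurable

theorem lintegral_add_three {a b c : ℝ → ENNReal} (ha : AEMeasurable a arc)
    (hb : AEMeasurable b arc) :
    ∫⁻ θ, a θ ∂arc + ∫⁻ θ, b θ ∂arc + ∫⁻ θ, c θ ∂arc = ∫⁻ θ, (a θ + b θ + c θ) ∂arc := by
  rw [← lintegral_add_left' ha, ← lintegral_add_left' (f := fun θ => a θ + b θ) (ha.add hb)]

theorem integral_linear_combination {a b c d : ℝ → ℂ} (ha : Integrable a arc)
    (hb : Integrable b arc) (hc : Integrable c arc) (hd : Integrable d arc) (k l : ℂ) :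
    ∫ θ, (-a θ - b θ + k * c θ + l * d θ) ∂arc =
      -∫ θ, a θ ∂arc - ∫ θ, b θ ∂arc + k * ∫ θ, c θ ∂arc + l * ∫ θ, d θ ∂arc := by
  have h1 : Integrable (fun θ => -a θ - b θ) arc := ha.neg.sub hb
  have h2 : Integrable (fun θ => -a θ - b θ + k * c θ) arc := h1.add (hc.const_mul k)
  rw [integral_add h2 (hd.const_mul l), integral_add h1 (hc.const_mul k),
    integral_sub (f := fun θ => -a θ) ha.neg hb, integral_neg, integral_const_mul,
    integral_const_mul]

/-- Bessel's inequality for A f + f / 4, whose weighted norm is controlled pointwise by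
`weighted_sq_le`. -/
theorem tsum_coeff_le_second_order {M : ℕ} (hM : 2 ≤ M) {f g h : ℝ → ℂ} (h1 : HasWeakDeriv f g)
    (h2 : HasWeakDeriv g h) (hf : SqInt 1 f) :
    ∑' j : ℕ, ENNReal.ofReal (((M : ℝ) + j + 1 / 2) ^ 4) * ‖legendreCoeff M j f‖ₑ ^ 2 ≤
      3 * (ENNReal.ofReal ((M : ℝ) ^ 4) * sinInt (-3) f + ENNReal.ofReal ((M : ℝ) ^ 2) *
        sinInt (-1) g + sinInt 1 h) := by
  rcases eq_or_ne (ENNReal.ofReal ((M : ℝ) ^ 4) * sinInt (-3) f + ENNReal.ofReal ((M : ℝ) ^ 2) *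
        sinInt (-1) g + sinInt 1 h) ⊤ with htop | htop
  · rw [htop, ENNReal.mul_top (by norm_num)]; exact le_top
  have hfm : AEStronglyMeasurable f arc := h1.1.aestronglyMeasurable
  have hgm : AEStronglyMeasurable g arc := h1.2.1.aestronglyMeasurable
  have hhm : AEStronglyMeasurable h arc := h2.2.1.aestronglyMeasurable
  have hM0 : (0 : ℝ) < M := by exact_mod_cast (by omega : 0 < M)
  obtain ⟨h12, hh0⟩ := ENNReal.add_ne_top.1 htop
  obtain ⟨hf0, hg0⟩ := ENNReal.add_ne_top.1 h12
  have hh : SqInt 1 h := sqInt_of_sinInt_ne_top hhm hh0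
  have hf3 : SqInt (-3) f := sqInt_of_sinInt_ne_top hfm fun ht => by
    rw [ht] at hf0
    exact hf0 (ENNReal.mul_top (by simpa using hM0.ne'))
  have hg1 : SqInt (-1) g := sqInt_of_sinInt_ne_top hgm fun ht => by
    rw [ht] at hg0
    exact hg0 (ENNReal.mul_top (by simpa using hM0.ne'))
  -- The summand 1/4 turns the eigenvalue n(n + 1) into exactly (n + 1/2)².
  set L : ℝ → ℂ := fun θ => -h θ - ((Real.cos θ / Real.sin θ : ℝ) : ℂ) * g θ +
    (((M : ℝ) ^ 2 / Real.sin θ ^ 2 + 1 / 4 : ℝ) : ℂ) * f θ with hL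
  have hLm : AEStronglyMeasurable L arc := by
    refine (hhm.neg.sub (AEStronglyMeasurable.mul ?_ hgm)).add (AEStronglyMeasurable.mul ?_ hfm)
    all_goals
      exact (Complex.measurable_ofReal.comp (by fun_prop)).aestronglyMeasurable
  have hLle : sinInt 1 L ≤ 3 * (ENNReal.ofReal ((M : ℝ) ^ 4) * sinInt (-3) f +
      ENNReal.ofReal ((M : ℝ) ^ 2) * sinInt (-1) g + sinInt 1 h) := by
    rw [lintegral_arc_const_mul_sinInt, lintegral_arc_const_mul_sinInt, sinInt, sinInt,
      lintegral_add_three ((aemeasurable_sinInt hfm _).const_mul _)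
        ((aemeasurable_sinInt hgm _).const_mul _),
      ← lintegral_const_mul' _ _ (by norm_num)]
    refine lintegral_mono_ae ?_
    filter_upwards [ae_arc_mem] with θ hθ
    have hs := Real.sin_pos_of_mem_Ioo hθ
    simp only [enorm_sq_eq_ofReal]
    rw [show (3 : ENNReal) = ENNReal.ofReal 3 by simp]
    have p1 : (0 : ℝ) ≤ Real.sin θ ^ (-3 : ℤ) := zpow_nonneg hs.le _
    have p2 : (0 : ℝ) ≤ Real.sin θ ^ (-1 : ℤ) := zpow_nonneg hs.le _
    have p3 : (0 : ℝ) ≤ Real.sin θ ^ (1 : ℤ) := zpow_nonneg hs.le _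
    simp only [← ENNReal.ofReal_mul (sq_nonneg _), ← ENNReal.ofReal_mul (by positivity : (0 : ℝ) ≤ M ^ 4)]
    rw [← ENNReal.ofReal_add (by positivity) (by positivity),
      ← ENNReal.ofReal_add (by positivity) (by positivity), ← ENNReal.ofReal_mul (by norm_num)]
    refine ENNReal.ofReal_le_ofReal ?_
    have key := weighted_sq_le hs (Real.sin_le_one θ) (norm_nonneg (f θ)) (norm_nonneg (g θ))
      (norm_nonneg (h θ)) (by exact_mod_cast hM : (2 : ℝ) ≤ M)
    rw [zpow_one, zpow_neg_one, show (-3 : ℤ) = -((3 : ℕ) : ℤ) by norm_num, zpow_neg, zpow_natCast]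
    refine le_trans ?_ key
    gcongr
    refine (norm_add_le _ _).trans (add_le_add ((norm_sub_le _ _).trans (add_le_add ?_ ?_)) ?_)
    · rw [norm_neg]
    · rw [norm_mul, Complex.norm_real, norm_div, Real.norm_of_nonneg hs.le, div_mul_eq_mul_div]
      gcongr
      exact mul_le_of_le_one_left (norm_nonneg _) (Real.abs_cos_le_one θ)
    · rw [norm_mul, Complex.norm_real, Real.norm_of_nonneg (by positivity)]
  have hLs : SqInt 1 L := sqInt_of_sinInt_ne_top hLm
    (ne_top_of_le_ne_top (ENNReal.mul_ne_top (by norm_num) htop) hLle)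
  have weaken : ∀ {k l : ℤ} {u : ℝ → ℂ}, k ≤ l → AEStronglyMeasurable u arc → SqInt k u →
      SqInt l u := by
    intro k l u hkl hum hu
    refine sqInt_of_sinInt_ne_top hum (ne_top_of_le_ne_top hu.sinInt_ne_top ?_)
    refine lintegral_mono_ae ?_
    filter_upwards [ae_arc_mem] with θ hθ
    gcongr ?_ * ENNReal.ofReal ?_
    · exact le_rfl
    · exact zpow_le_zpow_right_of_le_one₀ (Real.sin_pos_of_mem_Ioo hθ) (Real.sin_le_one θ) hkl
  have hf1 : SqInt (-1) f := weaken (by norm_num) hfm hf3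
  have hg2 : SqInt 1 g := weaken (by norm_num) hgm hg1
  have hLj : ∀ j, inner ℂ (sqInt_smoothQ M j).toL2 hLs.toL2 =
      ((fun _ => 1 : ℕ → ℝ) j : ℂ) *
        ((((M : ℝ) + j + 1 / 2) ^ 2 : ℝ) * legendreCoeff M j f) := by
    intro j
    have hq := continuous_smoothQ M j
    have hq' := continuous_deriv_smoothQ M j
    have hd : deriv (fun θ => Real.sin θ * smoothQ M j θ) = fun θ =>
        Real.cos θ * smoothQ M j θ + Real.sin θ * deriv (smoothQ M j) θ := funext fun θ =>
      ((Real.hasDerivAt_sin θ).mul ((contDiff_smoothQ M j (N := 1)).differentiable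
        one_ne_zero θ).hasDerivAt).deriv
    have i1 : Integrable (fun θ => ((Real.sin θ * smoothQ M j θ : ℝ) : ℂ) * h θ) arc :=
      hh.integrable_sin_mul hq
    have i2 : Integrable (fun θ => ((Real.cos θ * smoothQ M j θ : ℝ) : ℂ) * g θ) arc :=
      hg1.integrable_mul_of_neg (k := 1) (by fun_prop)
    have i3 : Integrable (fun θ => ((Real.sin θ * deriv (smoothQ M j) θ : ℝ) : ℂ) * g θ) arc :=
      hg1.integrable_mul_of_neg (k := 1) (by fun_prop)
    have i4 : Integrable (fun θ => (smoothR M j θ : ℂ) * f θ) arc :=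
      hf1.integrable_mul_of_neg (k := 1) (continuous_smoothR M j)
    have i5 : Integrable (fun θ => ((Real.sin θ * smoothQ M j θ : ℝ) : ℂ) * f θ) arc :=
      hf.integrable_sin_mul hq
    have i6 : Integrable (fun θ => (smoothQ M j θ : ℂ) * g θ) arc :=
      hg1.integrable_mul_of_neg (k := 1) hq
    -- Testing f'' with sin · q produces a term cos · q that cancels the cot f' term and leaves the
    -- form ∫ sin q' f' to which `form_eq` applies.
    have w := h2.integral_mul_eq (φ := fun θ => Real.sin θ * smoothQ M j θ)
      (Real.contDiff_sin.mul (contDiff_smoothQ M j))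
      (i6.congr (by
        filter_upwards [ae_arc_mem] with θ hθ
        rw [mul_div_cancel_left₀ _ (Real.sin_pos_of_mem_Ioo hθ).ne']))
      (by
        rw [hd]
        simp only [Complex.ofReal_add, add_mul]
        exact i2.add i3) i1
    rw [hd] at w
    simp only [Complex.ofReal_add, add_mul] at w
    rw [integral_add i2 i3] at w
    have fm := h1.form_eq (M := M) j hf (fun _ => hf1) hg2
    rw [inner_toL2_one_one]
    have e : ∫ θ, ((Real.sin θ * smoothQ M j θ : ℝ) : ℂ) * L θ ∂arc =
        ∫ θ, (-(((Real.sin θ * smoothQ M j θ : ℝ) : ℂ) * h θ) -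
          ((Real.cos θ * smoothQ M j θ : ℝ) : ℂ) * g θ + M * ((smoothR M j θ : ℂ) * f θ) +
          (1 / 4 : ℂ) * (((Real.sin θ * smoothQ M j θ : ℝ) : ℂ) * f θ)) ∂arc := by
      refine integral_congr_ae ?_
      filter_upwards [ae_arc_mem] with θ hθ
      have hs : (Real.sin θ : ℂ) ≠ 0 := by
        exact_mod_cast (Real.sin_pos_of_mem_Ioo hθ).ne'
      have hr : (smoothR M j θ : ℂ) * Real.sin θ = M * smoothQ M j θ := by
        exact_mod_cast smoothR_mul_sin M j θ
      rw [hL]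
      push_cast at hs hr ⊢
      have hr' : (smoothR M j θ : ℂ) = M * smoothQ M j θ / Complex.sin θ := by
        rw [← hr, mul_div_cancel_right₀ _ hs]
      rw [hr']
      field_simp
      ring
    rw [e, integral_linear_combination i1 i2 i4 i5, w]
    rw [legendreCoeff]
    unfold eigen at fm
    push_cast at fm ⊢
    linear_combination fm
  refine le_trans ?_ hLle
  rw [hLs.sinInt_eq_enorm, enorm_sq_eq_ofReal, ENNReal.tsum_eq_iSup_sum]
  refine iSup_le fun s => ?_
  rw [sum_ofReal_mul_enorm_sq fun j => by positivity]
  refine ENNReal.ofReal_le_ofReal ((le_of_eq ?_).trans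
    (sum_le_norm_sq_of_orthogonal (l := fun _ => 1) (inner_smoothQ M) hLj s))
  refine Finset.sum_congr rfl fun j _ => ?_
  rw [norm_mul, Complex.norm_real, Real.norm_of_nonneg (by positivity)]
  ring

/-! ### Closedness of differentiation and multiplication under L² series -/

theorem SqInt.locallyIntegrableOn {f : ℝ → ℂ} (hf : SqInt 1 f) :
    LocallyIntegrableOn f (Ioo 0 Real.pi) := by
  have h1 : IntegrableOn (fun θ => ((√(Real.sin θ) ^ (1 : ℤ) : ℝ) : ℂ) * f θ) (Ioo 0 Real.pi) :=
    MemLp.integrable (by norm_num) hf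
  have h2 := h1.locallyIntegrableOn.continuousOn_mul
    (g := fun θ => (((√(Real.sin θ))⁻¹ : ℝ) : ℂ)) ?_ isOpen_Ioo.isLocallyClosed
  · refine (locallyIntegrableOn_congr ?_).1 h2
    filter_upwards [ae_arc_mem] with θ hθ
    have := (sqrt_sin_pos hθ).ne'
    rw [zpow_one, ← mul_assoc, ← Complex.ofReal_mul, inv_mul_cancel₀ this, Complex.ofReal_one,
      one_mul]
  · refine Complex.continuous_ofReal.comp_continuousOn (ContinuousOn.inv₀ (by fun_prop) ?_)
    exact fun θ hθ => (sqrt_sin_pos hθ).ne'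

theorem exists_bound_sqrt_sin {η : ℝ → ℝ} (hη : Continuous η) (hc : HasCompactSupport η)
    (hs : tsupport η ⊆ Ioo 0 Real.pi) :
    ∃ C, ∀ θ ∈ Ioo 0 Real.pi, |η θ| ≤ C * √(Real.sin θ) ^ (-(-1) : ℤ) := by
  obtain ⟨C, hC⟩ := hc.isCompact.exists_bound_of_continuousOn
    (f := fun θ => η θ / √(Real.sin θ))
    (hη.continuousOn.div (by fun_prop) fun θ hθ => (sqrt_sin_pos (hs hθ)).ne')
  refine ⟨|C|, fun θ hθ => ?_⟩
  have hp := sqrt_sin_pos hθ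
  rw [neg_neg, zpow_one]
  by_cases h : θ ∈ tsupport η
  · have := (hC θ h).trans (le_abs_self C)
    rwa [norm_div, Real.norm_of_nonneg hp.le, div_le_iff₀ hp] at this
  · rw [image_eq_zero_of_notMem_tsupport h, abs_zero]
    positivity

/-- Weak derivatives are compatible with convergence in the weighted `L²` space. -/
theorem hasWeakDeriv_of_hasSum {u u' : ℕ → ℝ → ℂ} (hu : ∀ j, SqInt 1 (u j))
    (hu' : ∀ j, SqInt 1 (u' j)) (hw : ∀ j, HasWeakDeriv (u j) (u' j)) {a : ℕ → ℂ} {f g : ℝ → ℂ}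
    (hf : SqInt 1 f) (hg : SqInt 1 g) (h : HasSum (fun j => a j • (hu j).toL2) hf.toL2)
    (h' : HasSum (fun j => a j • (hu' j).toL2) hg.toL2) : HasWeakDeriv f g := by
  refine ⟨hf.locallyIntegrableOn, hg.locallyIntegrableOn, fun η hη hc hs => ?_⟩
  have hη' : Continuous (deriv η) := hη.continuous_deriv (by simp)
  obtain ⟨C, hC⟩ := exists_bound_sqrt_sin hη.continuous hc hs
  obtain ⟨C', hC'⟩ := exists_bound_sqrt_sin hη' hc.deriv ((tsupport_deriv_subset (f := η)).trans hs)
  have e := sqInt_of_bound hη.continuous hC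
  have e' := sqInt_of_bound hη' hC'
  -- A test function vanishes near the poles, so it lies in the space of weight sin⁻¹ dual to that
  -- of f and g.
  have s := h.mapL (innerSL ℂ e'.toL2)
  have s' := (h'.mapL (innerSL ℂ e.toL2)).neg
  simp only [innerSL_apply_apply, inner_smul_right,
    inner_toL2_of_add_eq_zero (show (-1 : ℤ) + 1 = 0 by norm_num)] at s s'
  refine s.unique (s'.congr_fun fun j => ?_)
  rw [(hw j).2.2 η hη hc hs, mul_neg]

theorem summable_of_norm_sum_sq_le {E : Type*} [NormedAddCommGroup E] [CompleteSpace E]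
    {x : ℕ → E} {b : ℕ → ℝ} (hb : Summable b)
    (h : ∀ t : Finset ℕ, ‖∑ j ∈ t, x j‖ ^ 2 ≤ ∑ j ∈ t, b j) : Summable x := by
  rw [summable_iff_vanishing_norm]
  intro ε hε
  obtain ⟨s, hs⟩ := summable_iff_vanishing_norm.1 hb (ε ^ 2) (by positivity)
  refine ⟨s, fun t ht => ?_⟩
  exact lt_of_pow_lt_pow_left₀ 2 hε.le ((h t).trans_lt ((le_abs_self _).trans_lt (hs t ht)))

theorem exists_toL2_eq (G : Lp ℂ 2 arc) : ∃ (g : ℝ → ℂ) (hg : SqInt 1 g), hg.toL2 = G := by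
  have e : (fun θ => ((√(Real.sin θ) ^ (1 : ℤ) : ℝ) : ℂ) *
      ((((√(Real.sin θ))⁻¹ : ℝ) : ℂ) * G θ)) =ᵐ[arc] G := by
    filter_upwards [ae_arc_mem] with θ hθ
    have := (sqrt_sin_pos hθ).ne'
    rw [zpow_one, ← mul_assoc, ← Complex.ofReal_mul, mul_inv_cancel₀ this, Complex.ofReal_one,
      one_mul]
  have hg : SqInt 1 (fun θ => (((√(Real.sin θ))⁻¹ : ℝ) : ℂ) * G θ) :=
    (memLp_congr_ae e).2 (Lp.memLp G)
  exact ⟨_, hg, Lp.ext (hg.coeFn_toL2.trans e)⟩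

theorem exists_weakDeriv_of_hasSum {u u' : ℕ → ℝ → ℂ} (hu : ∀ j, SqInt 1 (u j))
    (hu' : ∀ j, SqInt 1 (u' j)) (hw : ∀ j, HasWeakDeriv (u j) (u' j)) {a : ℕ → ℂ} {f : ℝ → ℂ}
    (hf : SqInt 1 f) (h : HasSum (fun j => a j • (hu j).toL2) hf.toL2) {b : ℕ → ℝ}
    (hb : Summable b)
    (hle : ∀ t : Finset ℕ, ‖∑ j ∈ t, a j • (hu' j).toL2‖ ^ 2 ≤ ∑ j ∈ t, b j) :
    ∃ (g : ℝ → ℂ) (hg : SqInt 1 g), HasWeakDeriv f g ∧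
      HasSum (fun j => a j • (hu' j).toL2) hg.toL2 := by
  obtain ⟨G, hG⟩ := summable_of_norm_sum_sq_le hb hle
  obtain ⟨g, hg, rfl⟩ := exists_toL2_eq G
  exact ⟨g, hg, hasWeakDeriv_of_hasSum hu hu' hw hf hg h hG, hG⟩

/-- Multiplication operators are closed. -/
theorem exists_mul_of_hasSum {u U : ℕ → ℝ → ℂ} (hu : ∀ j, SqInt 1 (u j))
    (hU : ∀ j, SqInt 1 (U j)) {κ : ℝ → ℂ} (hκ : ∀ j, ∀ θ ∈ Ioo 0 Real.pi, U j θ = κ θ * u j θ)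
    {a : ℕ → ℂ} {f : ℝ → ℂ} (hf : SqInt 1 f) (h : HasSum (fun j => a j • (hu j).toL2) hf.toL2)
    {b : ℕ → ℝ} (hb : Summable b)
    (hle : ∀ t : Finset ℕ, ‖∑ j ∈ t, a j • (hU j).toL2‖ ^ 2 ≤ ∑ j ∈ t, b j) :
    ∃ hg : SqInt 1 (fun θ => κ θ * f θ), HasSum (fun j => a j • (hU j).toL2) hg.toL2 := by
  obtain ⟨G, hG⟩ := summable_of_norm_sum_sq_le hb hle
  -- L² limits are compared pointwise: the second subsequence is taken inside the first, so that
  -- both partial sums converge almost everywhere along it.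
  obtain ⟨ns, hns, hF⟩ :=
    (tendstoInMeasure_of_tendsto_Lp h.tendsto_sum_nat).exists_seq_tendsto_ae
  obtain ⟨ms, hms, hG'⟩ := (tendstoInMeasure_of_tendsto_Lp
    (hG.tendsto_sum_nat.comp hns.tendsto_atTop)).exists_seq_tendsto_ae
  have hj : ∀ᵐ θ ∂arc, ∀ j, ((a j • (hU j).toL2 : Lp ℂ 2 arc) : ℝ → ℂ) θ =
      κ θ * ((a j • (hu j).toL2 : Lp ℂ 2 arc) : ℝ → ℂ) θ := by
    rw [ae_all_iff]
    intro j
    filter_upwards [Lp.coeFn_smul (a j) (hU j).toL2, Lp.coeFn_smul (a j) (hu j).toL2,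
      (hU j).coeFn_toL2, (hu j).coeFn_toL2, ae_arc_mem] with θ h1 h2 h3 h4 hθ
    rw [h1, h2, Pi.smul_apply, Pi.smul_apply, h3, h4, hκ j θ hθ, smul_eq_mul, smul_eq_mul]
    ring
  have hsU : ∀ᵐ θ ∂arc, ∀ n, ((∑ j ∈ Finset.range n, a j • (hU j).toL2 : Lp ℂ 2 arc) : ℝ → ℂ) θ =
      ∑ j ∈ Finset.range n, ((a j • (hU j).toL2 : Lp ℂ 2 arc) : ℝ → ℂ) θ := by
    rw [ae_all_iff]
    intro n
    filter_upwards [Lp.coeFn_finsetSum (Finset.range n) fun j => a j • (hU j).toL2] with θ h1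
    rw [h1, Finset.sum_apply]
  have hsu : ∀ᵐ θ ∂arc, ∀ n, ((∑ j ∈ Finset.range n, a j • (hu j).toL2 : Lp ℂ 2 arc) : ℝ → ℂ) θ =
      ∑ j ∈ Finset.range n, ((a j • (hu j).toL2 : Lp ℂ 2 arc) : ℝ → ℂ) θ := by
    rw [ae_all_iff]
    intro n
    filter_upwards [Lp.coeFn_finsetSum (Finset.range n) fun j => a j • (hu j).toL2] with θ h1
    rw [h1, Finset.sum_apply]
  have e : (fun θ => ((√(Real.sin θ) ^ (1 : ℤ) : ℝ) : ℂ) * (κ θ * f θ)) =ᵐ[arc] G := by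
    filter_upwards [hF, hG', hj, hsU, hsu, hf.coeFn_toL2] with θ h1 h2 h3 h4 h5 h6
    have l1 := ((h1.comp hms.tendsto_atTop).const_mul (κ θ))
    rw [h6] at l1
    refine (mul_left_comm _ _ _).trans (tendsto_nhds_unique (l1.congr fun k => ?_) h2)
    simp only [Function.comp_apply, h4, h5, h3, Finset.mul_sum]
  have hg : SqInt 1 (fun θ => κ θ * f θ) := (memLp_congr_ae e).2 (Lp.memLp G)
  refine ⟨hg, ?_⟩
  rwa [show hg.toL2 = G from Lp.ext (hg.coeFn_toL2.trans e)]

theorem sinInt_one_mul (c : ℝ) (k : ℤ) (f : ℝ → ℂ) :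
    sinInt 1 (fun θ => ((c / Real.sin θ ^ k : ℝ) : ℂ) * f θ) =
      ENNReal.ofReal (c ^ 2) * sinInt (1 - 2 * k) f := by
  rw [lintegral_arc_const_mul_sinInt]
  refine lintegral_congr_ae ?_
  filter_upwards [ae_arc_mem] with θ hθ
  have hs := Real.sin_pos_of_mem_Ioo hθ
  rw [enorm_sq_eq_ofReal, enorm_sq_eq_ofReal, ← ENNReal.ofReal_mul (by positivity),
    ← ENNReal.ofReal_mul (by positivity), ← ENNReal.ofReal_mul (by positivity), norm_mul,
    Complex.norm_real, mul_pow, Real.norm_eq_abs, sq_abs, zpow_sub₀ hs.ne', two_mul,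
    zpow_add₀ hs.ne']
  congr 1
  field_simp

theorem norm_sq_add_le_of_hasSum {E : Type*} [NormedAddCommGroup E] {x y z : ℕ → E} {X Y Z : E}
    (hx : HasSum x X) (hy : HasSum y Y) (hz : HasSum z Z) {b : ℕ → ℝ} (hb : Summable b)
    (hb0 : ∀ j, 0 ≤ b j) (k : ℝ)
    (h : ∀ t : Finset ℕ, k * ‖∑ j ∈ t, x j‖ ^ 2 + ‖∑ j ∈ t, y j‖ ^ 2 + ‖∑ j ∈ t, z j‖ ^ 2 ≤
      ∑ j ∈ t, b j) : k * ‖X‖ ^ 2 + ‖Y‖ ^ 2 + ‖Z‖ ^ 2 ≤ ∑' j, b j :=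
  le_of_tendsto' ((((Filter.Tendsto.norm hx).pow 2).const_mul k).add
    ((Filter.Tendsto.norm hy).pow 2) |>.add ((Filter.Tendsto.norm hz).pow 2))
    fun t => (h t).trans (hb.sum_le_tsum t fun j _ => hb0 j)

theorem summable_of_tsum_ofReal_ne_top {b : ℕ → ℝ} (hb : ∀ j, 0 ≤ b j)
    (h : ∑' j, ENNReal.ofReal (b j) ≠ ⊤) : Summable b := by
  have := ENNReal.summable_toReal h
  simpa only [ENNReal.toReal_ofReal (hb _)] using this

/-! ### First order lower bound -/

theorem norm_sum_formVec (M : ℕ) (a : ℕ → ℂ) (t : Finset ℕ) :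
    ‖∑ j ∈ t, a j • (sqInt_deriv_smoothQ M j).toL2‖ ^ 2 +
      ‖∑ j ∈ t, a j • (sqInt_smoothR M j).toL2‖ ^ 2 = ∑ j ∈ t, eigen M j * ‖a j‖ ^ 2 := by
  rw [← norm_sum_sq_of_orthogonal (inner_formVec M) a t]
  have e : ∑ j ∈ t, a j • formVec M j = WithLp.toLp 2
      (∑ j ∈ t, a j • (sqInt_deriv_smoothQ M j).toL2,
        ∑ j ∈ t, a j • (sqInt_smoothR M j).toL2) := by
    classical
    induction t using Finset.induction_on with
    | empty => simp; rfl
    | insert j t hj ih =>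
      rw [Finset.sum_insert hj, Finset.sum_insert hj, Finset.sum_insert hj, ih]
      rfl
  rw [e, WithLp.prod_norm_sq_eq_of_L2]
  rfl

theorem sq_le_of_sum_le {k x y z b : ℝ} (hk : 0 ≤ k) (h : k * x ^ 2 + y ^ 2 + z ^ 2 ≤ b) :
    y ^ 2 ≤ b ∧ z ^ 2 ≤ b := by
  have := mul_nonneg hk (sq_nonneg x)
  constructor <;> nlinarith [sq_nonneg y, sq_nonneg z]

/-- On partial sums the energy equals the partial spectral sum. This makes the expansions of f' and
M f / sin Cauchy, and the bound passes to the limit. -/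
theorem exists_weakDeriv_first_order {M : ℕ} {f : ℝ → ℂ} (hf : SqInt 1 f)
    (hs : ∑' j : ℕ, ENNReal.ofReal (((M : ℝ) + j + 1 / 2) ^ 2) * ‖legendreCoeff M j f‖ₑ ^ 2 ≠ ⊤) :
    ∃ (g : ℝ → ℂ) (hg : SqInt 1 g), HasWeakDeriv f g ∧
      HasSum (fun j => legendreCoeff M j f • (sqInt_deriv_smoothQ M j).toL2) hg.toL2 ∧
      ENNReal.ofReal (1 / 4) * sinInt 1 f + ENNReal.ofReal ((M : ℝ) ^ 2) * sinInt (-1) f +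
        sinInt 1 g ≤
      ∑' j : ℕ, ENNReal.ofReal (((M : ℝ) + j + 1 / 2) ^ 2) * ‖legendreCoeff M j f‖ₑ ^ 2 := by
  set a := fun j => legendreCoeff M j f with ha
  set b : ℕ → ℝ := fun j => ((M : ℝ) + j + 1 / 2) ^ 2 * ‖a j‖ ^ 2 with hb
  have hb0 : ∀ j, 0 ≤ b j := fun j => by positivity
  have eb : ∀ j : ℕ, ENNReal.ofReal (((M : ℝ) + j + 1 / 2) ^ 2) * ‖legendreCoeff M j f‖ₑ ^ 2 =
      ENNReal.ofReal (b j) := fun j => by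
    rw [enorm_sq_eq_ofReal, ← ENNReal.ofReal_mul (by positivity)]
  simp only [eb] at hs ⊢
  have hbs := summable_of_tsum_ofReal_ne_top hb0 hs
  have hsum := hf.hasSum_smoothQ M
  have energy : ∀ t : Finset ℕ, 1 / 4 * ‖∑ j ∈ t, a j • (sqInt_smoothQ M j).toL2‖ ^ 2 +
      ‖∑ j ∈ t, a j • (sqInt_smoothR M j).toL2‖ ^ 2 +
      ‖∑ j ∈ t, a j • (sqInt_deriv_smoothQ M j).toL2‖ ^ 2 ≤ ∑ j ∈ t, b j := by
    intro t
    have h1 := norm_sum_formVec M a t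
    have h2 := norm_sum_sq_of_orthogonal (l := fun _ => 1) (inner_smoothQ M) a t
    rw [h2, add_assoc, add_comm (‖_‖ ^ 2), h1, Finset.mul_sum, ← Finset.sum_add_distrib]
    exact (Finset.sum_congr rfl fun j _ => by simp only [eigen, hb]; ring).le
  obtain ⟨g, hg, hw, hgs⟩ := exists_weakDeriv_of_hasSum (sqInt_smoothQ M) (sqInt_deriv_smoothQ M)
    (fun j => hasWeakDeriv_ofReal (contDiff_smoothQ M j)) hf hsum hbs
    (fun t => (sq_le_of_sum_le (by norm_num) (energy t)).2)
  obtain ⟨hk, hks⟩ := exists_mul_of_hasSum (sqInt_smoothQ M) (sqInt_smoothR M)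
    (κ := fun θ => ((M / Real.sin θ ^ (1 : ℤ) : ℝ) : ℂ)) (fun j θ hθ => by
      have hs := (Real.sin_pos_of_mem_Ioo hθ).ne'
      rw [← Complex.ofReal_mul, zpow_one, div_mul_eq_mul_div, ← smoothR_mul_sin,
        mul_div_cancel_right₀ _ hs]) hf hsum hbs
    (fun t => (sq_le_of_sum_le (by norm_num) (energy t)).1)
  refine ⟨g, hg, hw, hgs, ?_⟩
  have key := norm_sq_add_le_of_hasSum hsum hks hgs hbs hb0 (1 / 4) energy
  have e2 := sinInt_one_mul M 1 f
  rw [show (1 : ℤ) - 2 * 1 = -1 by norm_num] at e2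
  rw [← e2, hf.sinInt_eq_enorm, hk.sinInt_eq_enorm, hg.sinInt_eq_enorm, enorm_sq_eq_ofReal,
    enorm_sq_eq_ofReal, enorm_sq_eq_ofReal, ← ENNReal.ofReal_mul (by norm_num),
    ← ENNReal.ofReal_add (by positivity) (by positivity),
    ← ENNReal.ofReal_add (by positivity) (by positivity),
    ← ENNReal.ofReal_tsum_of_nonneg hb0 hbs]
  exact ENNReal.ofReal_le_ofReal key

/-! ### Second order energy inequality and lower bound -/

theorem integrable_arc_of_continuous {u : ℝ → ℝ} (hu : Continuous u) : Integrable u arc :=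
  (hu.integrableOn_Icc (a := 0) (b := Real.pi)).mono_set Ioo_subset_Icc_self

theorem integral_arc_eq (u : ℝ → ℝ) : ∫ θ, u θ ∂arc = ∫ θ in (0 : ℝ)..Real.pi, u θ := by
  rw [← integral_Ioc_eq_integral_Ioo, ← intervalIntegral.integral_of_le Real.pi_pos.le]

/-- The second order energy inequality for `p = sin² ρ` with `p' = sin σ` and
`p'' = cos σ + sin τ`. -/
theorem second_order_energy {ρ ρ' σ τ : ℝ → ℝ} {m : ℝ} (hm : 2 ≤ m)
    (hρ : ∀ θ, HasDerivAt ρ (ρ' θ) θ) (hσ : ∀ θ, HasDerivAt σ (τ θ) θ)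
    (h1 : ∀ θ, Real.sin θ * ρ' θ = σ θ - 2 * Real.cos θ * ρ θ)
    (hρ' : Continuous ρ') (hτ : Continuous τ) :
    ∫ θ, Real.sin θ * ((m ^ 2 * ρ θ) ^ 2 + (m * σ θ) ^ 2 +
        (Real.cos θ * σ θ + Real.sin θ * τ θ) ^ 2) ∂arc ≤
      ∫ θ, 3 * (Real.sin θ *
        (m ^ 2 * ρ θ - 2 * Real.cos θ * σ θ - Real.sin θ * τ θ) ^ 2) ∂arc := by
  have hρc : Continuous ρ := continuous_iff_continuousAt.2 fun θ => (hρ θ).continuousAt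
  have hσc : Continuous σ := continuous_iff_continuousAt.2 fun θ => (hσ θ).continuousAt
  -- G vanishes at both poles, so subtracting G' does not change the integral. Its coefficients are
  -- those that remove the mixed terms and leave the sum of squares `e` below.
  set G : ℝ → ℝ := fun θ => 3 * (Real.sin θ ^ 2 * σ θ ^ 2 * Real.cos θ) -
    6 * m ^ 2 * (Real.sin θ ^ 2 * (ρ θ * σ θ)) +
    (3 - m ^ 2) * (Real.sin θ ^ 2 * ρ θ ^ 2 * Real.cos θ) with hG
  set G' : ℝ → ℝ := fun θ => 3 * ((2 * Real.sin θ * Real.cos θ * σ θ ^ 2 +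
      Real.sin θ ^ 2 * (2 * σ θ * τ θ)) * Real.cos θ - Real.sin θ ^ 3 * σ θ ^ 2) -
    6 * m ^ 2 * (2 * Real.sin θ * Real.cos θ * (ρ θ * σ θ) +
      Real.sin θ ^ 2 * (ρ' θ * σ θ + ρ θ * τ θ)) +
    (3 - m ^ 2) * ((2 * Real.sin θ * Real.cos θ * ρ θ ^ 2 +
      Real.sin θ ^ 2 * (2 * ρ θ * ρ' θ)) * Real.cos θ - Real.sin θ ^ 3 * ρ θ ^ 2) with hG'
  have hd : ∀ θ, HasDerivAt G (G' θ) θ := fun θ => by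
    have s := Real.hasDerivAt_sin θ
    have c := Real.hasDerivAt_cos θ
    have d1 := ((((s.fun_pow 2).fun_mul ((hσ θ).fun_pow 2)).fun_mul c).const_mul 3)
    have d2 := (((s.fun_pow 2).fun_mul ((hρ θ).fun_mul (hσ θ))).const_mul (6 * m ^ 2))
    have d3 := ((((s.fun_pow 2).fun_mul ((hρ θ).fun_pow 2)).fun_mul c).const_mul (3 - m ^ 2))
    refine ((d1.fun_sub d2).fun_add d3).congr_deriv ?_
    simp only [hG', Nat.cast_ofNat, Nat.add_one_sub_one, pow_one]
    ring
  have hGc : Continuous G' := by rw [hG']; fun_prop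
  have hG0 := integral_eq_zero_of_hasDerivAt hd hGc (by simp [hG]) (by simp [hG])
  have iA : Integrable (fun θ => 3 * (Real.sin θ *
      (m ^ 2 * ρ θ - 2 * Real.cos θ * σ θ - Real.sin θ * τ θ) ^ 2)) arc :=
    integrable_arc_of_continuous (by fun_prop)
  have iB : Integrable (fun θ => Real.sin θ * ((m ^ 2 * ρ θ) ^ 2 + (m * σ θ) ^ 2 +
      (Real.cos θ * σ θ + Real.sin θ * τ θ) ^ 2)) arc :=
    integrable_arc_of_continuous (by fun_prop)
  rw [← integral_arc_eq] at hG0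
  suffices step : 0 ≤ ∫ θ, (3 * (Real.sin θ *
      (m ^ 2 * ρ θ - 2 * Real.cos θ * σ θ - Real.sin θ * τ θ) ^ 2) -
      Real.sin θ * ((m ^ 2 * ρ θ) ^ 2 + (m * σ θ) ^ 2 +
        (Real.cos θ * σ θ + Real.sin θ * τ θ) ^ 2) - G' θ) ∂arc by
    rw [integral_sub (iA.sub' iB) (integrable_arc_of_continuous hGc), integral_sub iA iB, hG0] at step
    linarith
  refine integral_nonneg_of_ae ?_
  filter_upwards [ae_arc_mem] with θ hθ
  simp only [Pi.zero_apply]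
  have hs := Real.sin_pos_of_mem_Ioo hθ
  have hc : Real.cos θ ^ 2 = 1 - Real.sin θ ^ 2 := Real.cos_sq' θ
  have hm4 : 4 ≤ m ^ 2 := by nlinarith
  have e : 3 * (Real.sin θ * (m ^ 2 * ρ θ - 2 * Real.cos θ * σ θ - Real.sin θ * τ θ) ^ 2) -
      Real.sin θ * ((m ^ 2 * ρ θ) ^ 2 + (m * σ θ) ^ 2 +
        (Real.cos θ * σ θ + Real.sin θ * τ θ) ^ 2) - G' θ =
      Real.sin θ * (2 * (Real.cos θ * σ θ + Real.sin θ * τ θ) ^ 2 +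
        (5 * m ^ 2 + 3) * (σ θ - Real.cos θ * ρ θ) ^ 2 +
        (2 * m ^ 4 - 7 * m ^ 2 + 3 + 6 * m ^ 2 * Real.sin θ ^ 2) * ρ θ ^ 2) := by
    simp only [hG']
    linear_combination (6 * m ^ 2 * Real.sin θ * σ θ -
        2 * (3 - m ^ 2) * Real.sin θ * ρ θ * Real.cos θ) * h1 θ -
      Real.sin θ * (7 * m ^ 2 * ρ θ ^ 2 - 3 * ρ θ ^ 2 - 3 * σ θ ^ 2) * hc
  rw [e]
  -- The factorization is (2m² - 1)(m² - 3): nonnegative for m ≥ 2, negative for m = 1.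
  have h7 : 0 ≤ 2 * m ^ 4 - 7 * m ^ 2 + 3 := by nlinarith
  positivity

/-- `smoothQ M j / sin²` for `2 ≤ M`, extended to a smooth function. -/
def smoothRho (M j : ℕ) (θ : ℝ) : ℝ :=
  legendreK M j * trigPoly (M - 2) (legendreW M (M + j)) θ

/-- `(smoothQ M j)' / sin` for `2 ≤ M`, extended to a smooth function. -/
def smoothSigma (M j : ℕ) (θ : ℝ) : ℝ :=
  2 * Real.cos θ * smoothRho M j θ + Real.sin θ * deriv (smoothRho M j) θ

theorem contDiff_smoothRho (M j : ℕ) {N : WithTop ℕ∞} : ContDiff ℝ N (smoothRho M j) :=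
  contDiff_const.mul (contDiff_trigPoly _ _)

theorem contDiff_deriv_smoothRho (M j : ℕ) {N : ℕ∞} : ContDiff ℝ N (deriv (smoothRho M j)) :=
  (contDiff_succ_iff_deriv.1 (contDiff_smoothRho M j (N := N + 1))).2.2

theorem contDiff_smoothSigma (M j : ℕ) {N : ℕ∞} : ContDiff ℝ N (smoothSigma M j) :=
  ((contDiff_const.mul Real.contDiff_cos).mul (contDiff_smoothRho M j)).add
    (Real.contDiff_sin.mul (contDiff_deriv_smoothRho M j))

theorem continuous_smoothRho (M j : ℕ) : Continuous (smoothRho M j) :=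
  (contDiff_smoothRho M j (N := 0)).continuous

theorem continuous_deriv_smoothRho (M j : ℕ) : Continuous (deriv (smoothRho M j)) :=
  (contDiff_deriv_smoothRho M j (N := 0)).continuous

theorem continuous_smoothSigma (M j : ℕ) : Continuous (smoothSigma M j) :=
  (contDiff_smoothSigma M j (N := 0)).continuous

theorem continuous_deriv_smoothSigma (M j : ℕ) : Continuous (deriv (smoothSigma M j)) :=
  (contDiff_smoothSigma M j (N := 1)).continuous_deriv le_rfl

theorem hasDerivAt_smoothRho (M j : ℕ) (θ : ℝ) :
    HasDerivAt (smoothRho M j) (deriv (smoothRho M j) θ) θ :=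
  ((contDiff_smoothRho M j (N := 1)).differentiable one_ne_zero θ).hasDerivAt

theorem hasDerivAt_smoothSigma (M j : ℕ) (θ : ℝ) :
    HasDerivAt (smoothSigma M j) (deriv (smoothSigma M j) θ) θ :=
  ((contDiff_smoothSigma M j (N := 1)).differentiable one_ne_zero θ).hasDerivAt

theorem smoothQ_eq_sin_sq_mul {M : ℕ} (hM : 2 ≤ M) (j : ℕ) :
    smoothQ M j = fun θ => Real.sin θ ^ 2 * smoothRho M j θ := by
  obtain ⟨N, rfl⟩ := Nat.exists_eq_add_of_le hM
  ext θ
  simp only [smoothQ, smoothRho, trigPoly, Nat.add_sub_cancel_left, pow_add]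
  ring

theorem deriv_smoothQ_eq_sin_mul {M : ℕ} (hM : 2 ≤ M) (j : ℕ) :
    deriv (smoothQ M j) = fun θ => Real.sin θ * smoothSigma M j θ := by
  ext θ
  rw [smoothQ_eq_sin_sq_mul hM]
  refine ((((Real.hasDerivAt_sin θ).fun_pow 2).fun_mul (hasDerivAt_smoothRho M j θ)).congr_deriv
    ?_).deriv
  simp only [smoothSigma, Nat.cast_ofNat, Nat.add_one_sub_one, pow_one]
  ring

theorem deriv_deriv_smoothQ {M : ℕ} (hM : 2 ≤ M) (j : ℕ) :
    deriv (deriv (smoothQ M j)) = fun θ =>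
      Real.cos θ * smoothSigma M j θ + Real.sin θ * deriv (smoothSigma M j) θ := by
  ext θ
  rw [deriv_smoothQ_eq_sin_mul hM]
  exact ((Real.hasDerivAt_sin θ).fun_mul (hasDerivAt_smoothSigma M j θ)).deriv

theorem eigen_mul_smoothQ {M : ℕ} (hM : 2 ≤ M) (j : ℕ) {θ : ℝ} (hθ : θ ∈ Ioo 0 Real.pi) :
    (M : ℝ) ^ 2 * smoothRho M j θ - 2 * Real.cos θ * smoothSigma M j θ -
      Real.sin θ * deriv (smoothSigma M j) θ = eigen M j * smoothQ M j θ := by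
  have hs := (Real.sin_pos_of_mem_Ioo hθ).ne'
  have h1 := hasDerivAt_sin_mul_deriv_smoothQ M j θ
  have h2 := (Real.hasDerivAt_sin θ).fun_mul
    ((contDiff_deriv_smoothQ M j (N := 1)).differentiable one_ne_zero θ).hasDerivAt
  have h3 := h1.unique h2
  rw [deriv_deriv_smoothQ hM, deriv_smoothQ_eq_sin_mul hM] at h3
  have hr : smoothR M j θ = M * (Real.sin θ * smoothRho M j θ) := by
    apply mul_right_cancel₀ hs
    rw [smoothR_mul_sin, smoothQ_eq_sin_sq_mul hM]
    ring
  rw [hr] at h3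
  apply mul_left_cancel₀ hs
  linear_combination h3

/-- Reduces complex coefficients to real ones, for which the energy inequality is available. -/
theorem norm_sum_sq_of_real {E : Type*} [NormedAddCommGroup E] [InnerProductSpace ℂ E]
    {v : ℕ → E} (hv : ∀ i j, (inner ℂ (v i) (v j)).im = 0) (a : ℕ → ℂ) (t : Finset ℕ) :
    ‖∑ j ∈ t, a j • v j‖ ^ 2 = ‖∑ j ∈ t, ((a j).re : ℂ) • v j‖ ^ 2 +
      ‖∑ j ∈ t, ((a j).im : ℂ) • v j‖ ^ 2 := by
  set X := ∑ j ∈ t, ((a j).re : ℂ) • v j with hX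
  set Y := ∑ j ∈ t, ((a j).im : ℂ) • v j with hY
  have e : ∑ j ∈ t, a j • v j = X + Complex.I • Y := by
    rw [hX, hY, Finset.smul_sum, ← Finset.sum_add_distrib]
    refine Finset.sum_congr rfl fun j _ => ?_
    rw [smul_smul, ← add_smul, mul_comm, Complex.re_add_im]
  have hXY : (inner ℂ X Y).im = 0 := by
    rw [hX, hY, sum_inner, Complex.im_sum]
    refine Finset.sum_eq_zero fun i _ => ?_
    rw [inner_sum, Complex.im_sum]
    refine Finset.sum_eq_zero fun j _ => ?_
    rw [inner_smul_left, inner_smul_right, Complex.conj_ofReal, Complex.im_ofReal_mul,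
      Complex.im_ofReal_mul, hv]
    simp
  rw [e, @norm_add_sq ℂ, inner_smul_right, norm_smul, Complex.norm_I, one_mul]
  have : RCLike.re (Complex.I * inner ℂ X Y) = 0 := by
    rw [show RCLike.re (Complex.I * inner ℂ X Y) = (Complex.I * inner ℂ X Y).re from rfl,
      Complex.I_mul_re, hXY, neg_zero]
  rw [this]
  ring

theorem im_inner_toL2 {u v : ℝ → ℝ} (hu : SqInt 1 (fun θ => (u θ : ℂ)))
    (hv : SqInt 1 (fun θ => (v θ : ℂ))) : (inner ℂ hu.toL2 hv.toL2).im = 0 := by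
  rw [inner_toL2_one_one]
  simp only [← Complex.ofReal_mul, integral_complex_ofReal, Complex.ofReal_im]

theorem norm_sum_toL2_sq {u : ℕ → ℝ → ℝ} (hc : ∀ j, Continuous (u j))
    (hu : ∀ j, SqInt 1 (fun θ => (u j θ : ℂ))) (c : ℕ → ℝ) (t : Finset ℕ) :
    ‖∑ j ∈ t, (c j : ℂ) • (hu j).toL2‖ ^ 2 =
      ∫ θ, Real.sin θ * (∑ j ∈ t, c j * u j θ) ^ 2 ∂arc := by
  have h : SqInt 1 (fun θ => ((∑ j ∈ t, c j * u j θ : ℝ) : ℂ)) :=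
    sqInt_one_of_continuous (by fun_prop)
  have e : ∑ j ∈ t, (c j : ℂ) • (hu j).toL2 = h.toL2 := by
    refine Lp.ext ?_
    have hj : ∀ᵐ θ ∂arc, ∀ j, (((c j : ℂ) • (hu j).toL2 : Lp ℂ 2 arc) : ℝ → ℂ) θ =
        c j * (((√(Real.sin θ) ^ (1 : ℤ) : ℝ) : ℂ) * u j θ) := by
      rw [ae_all_iff]
      intro j
      filter_upwards [Lp.coeFn_smul (c j : ℂ) (hu j).toL2, (hu j).coeFn_toL2] with θ h1 h2
      rw [h1, Pi.smul_apply, h2, smul_eq_mul]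
    filter_upwards [Lp.coeFn_finsetSum t fun j => (c j : ℂ) • (hu j).toL2, hj, h.coeFn_toL2]
      with θ h1 h2 h3
    rw [h1, h3, Finset.sum_apply]
    simp only [h2, Complex.ofReal_sum, Finset.mul_sum]
    refine Finset.sum_congr rfl fun j _ => ?_
    push_cast
    ring
  have h2 := inner_toL2_one_one h h
  rw [@inner_self_eq_norm_sq_to_K ℂ] at h2
  simp only [← Complex.ofReal_mul, integral_complex_ofReal] at h2
  rw [e]
  have h3 : ‖h.toL2‖ ^ 2 = _ := Complex.ofReal_injective ((Complex.ofReal_pow _ _).trans h2)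
  rw [h3]
  congr 1
  ext θ
  ring

/-- `second_order_energy` for p = Σ c_j q_j: A p has coefficients n(n + 1) c_j, so orthonormality
evaluates the right-hand side. -/
theorem norm_sum_second_order_le_real {M : ℕ} (hM : 2 ≤ M)
    (h0 : ∀ j, SqInt 1 (fun θ => (((M : ℝ) ^ 2 * smoothRho M j θ : ℝ) : ℂ)))
    (h1 : ∀ j, SqInt 1 (fun θ => ((M * smoothSigma M j θ : ℝ) : ℂ)))
    (h2 : ∀ j, SqInt 1 (fun θ => ((deriv (deriv (smoothQ M j)) θ : ℝ) : ℂ)))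
    (c : ℕ → ℝ) (t : Finset ℕ) :
    ‖∑ j ∈ t, (c j : ℂ) • (h0 j).toL2‖ ^ 2 + ‖∑ j ∈ t, (c j : ℂ) • (h1 j).toL2‖ ^ 2 +
      ‖∑ j ∈ t, (c j : ℂ) • (h2 j).toL2‖ ^ 2 ≤ ∑ j ∈ t, 3 * (eigen M j * c j) ^ 2 := by
  have cρ := continuous_smoothRho M
  have cσ := continuous_smoothSigma M
  have cρ' := continuous_deriv_smoothRho M
  have cτ := continuous_deriv_smoothSigma M
  have c2 : ∀ j, Continuous (deriv (deriv (smoothQ M j))) := fun j => by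
    rw [deriv_deriv_smoothQ hM]
    have := cσ j; have := cτ j; fun_prop
  have key := second_order_energy (ρ := fun θ => ∑ j ∈ t, c j * smoothRho M j θ)
    (ρ' := fun θ => ∑ j ∈ t, c j * deriv (smoothRho M j) θ)
    (σ := fun θ => ∑ j ∈ t, c j * smoothSigma M j θ)
    (τ := fun θ => ∑ j ∈ t, c j * deriv (smoothSigma M j) θ) (m := M) (by exact_mod_cast hM)
    (fun θ => HasDerivAt.fun_sum fun j _ => (hasDerivAt_smoothRho M j θ).const_mul (c j))
    (fun θ => HasDerivAt.fun_sum fun j _ => (hasDerivAt_smoothSigma M j θ).const_mul (c j))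
    (fun θ => by
      simp only [Finset.mul_sum, ← Finset.sum_sub_distrib]
      exact Finset.sum_congr rfl fun j _ => by rw [smoothSigma]; ring)
    (by fun_prop) (by fun_prop)
  have hq := norm_sum_toL2_sq (continuous_smoothQ M) (sqInt_smoothQ M)
    (fun j => eigen M j * c j) t
  rw [norm_sum_sq_of_orthogonal (l := fun _ => 1) (inner_smoothQ M)
    (fun j => ((eigen M j * c j : ℝ) : ℂ))] at hq
  have e1 : ∫ θ, 3 * (Real.sin θ * ((M : ℝ) ^ 2 * ∑ j ∈ t, c j * smoothRho M j θ -
      2 * Real.cos θ * ∑ j ∈ t, c j * smoothSigma M j θ -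
      Real.sin θ * ∑ j ∈ t, c j * deriv (smoothSigma M j) θ) ^ 2) ∂arc =
      3 * ∫ θ, Real.sin θ * (∑ j ∈ t, eigen M j * c j * smoothQ M j θ) ^ 2 ∂arc := by
    rw [← integral_const_mul]
    refine integral_congr_ae ?_
    filter_upwards [ae_arc_mem] with θ hθ
    congr 4
    simp only [Finset.mul_sum, ← Finset.sum_sub_distrib]
    refine Finset.sum_congr rfl fun j _ => ?_
    linear_combination c j * eigen_mul_smoothQ hM j hθ
  rw [e1, ← hq, Finset.mul_sum] at key
  refine le_trans (le_of_eq ?_) (key.trans (le_of_eq ?_))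
  · rw [norm_sum_toL2_sq (fun j => continuous_const.mul (cρ j)),
      norm_sum_toL2_sq (fun j => continuous_const.mul (cσ j)), norm_sum_toL2_sq c2,
      ← integral_add (integrable_arc_of_continuous (by fun_prop))
        (integrable_arc_of_continuous (by fun_prop)),
      ← integral_add (integrable_arc_of_continuous (by fun_prop))
        (integrable_arc_of_continuous (by fun_prop))]
    congr 1
    ext θ
    rw [mul_add, mul_add]
    congr 4
    · rw [Finset.mul_sum]
      exact Finset.sum_congr rfl fun j _ => by simp only [Pi.mul_apply]; ring
    · rw [Finset.mul_sum]
      exact Finset.sum_congr rfl fun j _ => by simp only [Pi.mul_apply]; ring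
    · rw [Finset.mul_sum, Finset.mul_sum, ← Finset.sum_add_distrib]
      exact Finset.sum_congr rfl fun j _ => by rw [deriv_deriv_smoothQ hM]; ring
  · refine Finset.sum_congr rfl fun j _ => ?_
    rw [Complex.norm_real, Real.norm_eq_abs, sq_abs, one_mul]

theorem exists_weakDeriv_second_order {M : ℕ} (hM : 2 ≤ M) {f : ℝ → ℂ} (hf : SqInt 1 f)
    (hs : ∑' j : ℕ, ENNReal.ofReal (((M : ℝ) + j + 1 / 2) ^ 4) * ‖legendreCoeff M j f‖ₑ ^ 2 ≠ ⊤) :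
    ∃ g h : ℝ → ℂ, HasWeakDeriv f g ∧ HasWeakDeriv g h ∧
      ENNReal.ofReal ((M : ℝ) ^ 4) * sinInt (-3) f + ENNReal.ofReal ((M : ℝ) ^ 2) *
        sinInt (-1) g + sinInt 1 h ≤
      3 * ∑' j : ℕ, ENNReal.ofReal (((M : ℝ) + j + 1 / 2) ^ 4) *
        ‖legendreCoeff M j f‖ₑ ^ 2 := by
  have hM1 : (1 : ℝ) ≤ M := by exact_mod_cast (by omega : 1 ≤ M)
  -- As n + 1/2 ≥ 1, finiteness of the second order series implies that of the first order one.
  obtain ⟨g, hg, hfg, hgs, -⟩ := exists_weakDeriv_first_order (M := M) hf (by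
    refine ne_top_of_le_ne_top hs (ENNReal.tsum_le_tsum fun j => ?_)
    gcongr
    · have : (0 : ℝ) ≤ j := Nat.cast_nonneg j
      linarith
    · norm_num)
  set a := fun j => legendreCoeff M j f with ha
  set b : ℕ → ℝ := fun j => 3 * (((M : ℝ) + j + 1 / 2) ^ 4 * ‖a j‖ ^ 2) with hb
  have hb0 : ∀ j, 0 ≤ b j := fun j => by positivity
  have eb : 3 * ∑' j : ℕ, ENNReal.ofReal (((M : ℝ) + j + 1 / 2) ^ 4) *
      ‖legendreCoeff M j f‖ₑ ^ 2 = ∑' j, ENNReal.ofReal (b j) := by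
    rw [← ENNReal.tsum_mul_left]
    refine tsum_congr fun j => ?_
    rw [enorm_sq_eq_ofReal, ← ENNReal.ofReal_mul (by positivity),
      show (3 : ENNReal) = ENNReal.ofReal 3 by simp, ← ENNReal.ofReal_mul (by norm_num)]
  have hs3 := ENNReal.mul_ne_top (a := 3) (by norm_num) hs
  rw [eb] at hs3 ⊢
  have hbs := summable_of_tsum_ofReal_ne_top hb0 hs3
  have cd : ∀ j, ContDiff ℝ 1 (deriv (smoothQ M j)) := fun j => contDiff_deriv_smoothQ M j
  have h0 : ∀ j, SqInt 1 (fun θ => (((M : ℝ) ^ 2 * smoothRho M j θ : ℝ) : ℂ)) := fun j =>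
    sqInt_one_of_continuous (continuous_const.mul (continuous_smoothRho M j))
  have h1 : ∀ j, SqInt 1 (fun θ => ((M * smoothSigma M j θ : ℝ) : ℂ)) := fun j =>
    sqInt_one_of_continuous (continuous_const.mul (continuous_smoothSigma M j))
  have h2 : ∀ j, SqInt 1 (fun θ => ((deriv (deriv (smoothQ M j)) θ : ℝ) : ℂ)) := fun j =>
    sqInt_one_of_continuous ((cd j).continuous_deriv le_rfl)
  have energy : ∀ t : Finset ℕ, 1 * ‖∑ j ∈ t, a j • (h0 j).toL2‖ ^ 2 +
      ‖∑ j ∈ t, a j • (h1 j).toL2‖ ^ 2 + ‖∑ j ∈ t, a j • (h2 j).toL2‖ ^ 2 ≤ ∑ j ∈ t, b j := by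
    intro t
    rw [one_mul, norm_sum_sq_of_real (fun i j => im_inner_toL2 (h0 i) (h0 j)),
      norm_sum_sq_of_real (fun i j => im_inner_toL2 (h1 i) (h1 j)),
      norm_sum_sq_of_real (fun i j => im_inner_toL2 (h2 i) (h2 j))]
    have r1 := norm_sum_second_order_le_real hM h0 h1 h2 (fun j => (a j).re) t
    have r2 := norm_sum_second_order_le_real hM h0 h1 h2 (fun j => (a j).im) t
    have r3 : ∑ j ∈ t, 3 * (eigen M j * (a j).re) ^ 2 + ∑ j ∈ t, 3 * (eigen M j * (a j).im) ^ 2 ≤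
        ∑ j ∈ t, b j := by
      rw [← Finset.sum_add_distrib]
      refine Finset.sum_le_sum fun j _ => ?_
      have e1 : 3 * (eigen M j * (a j).re) ^ 2 + 3 * (eigen M j * (a j).im) ^ 2 =
          3 * (eigen M j ^ 2 * ‖a j‖ ^ 2) := by
        rw [Complex.sq_norm, Complex.normSq_apply]; ring
      have e2 : eigen M j ^ 2 ≤ ((M : ℝ) + j + 1 / 2) ^ 4 := by
        rw [show ((M : ℝ) + j + 1 / 2) ^ 4 = (((M : ℝ) + j + 1 / 2) ^ 2) ^ 2 by ring]
        refine pow_le_pow_left₀ (eigen_nonneg M j) ?_ 2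
        unfold eigen
        nlinarith
      rw [e1]
      simp only [hb]
      gcongr
    linarith
  obtain ⟨h, hh, hgh, hhs⟩ := exists_weakDeriv_of_hasSum (sqInt_deriv_smoothQ M) h2
    (fun j => hasWeakDeriv_ofReal (cd j)) hg hgs hbs
    (fun t => (sq_le_of_sum_le zero_le_one (energy t)).2)
  obtain ⟨hk1, hks1⟩ := exists_mul_of_hasSum (sqInt_deriv_smoothQ M) h1
    (κ := fun θ => ((M / Real.sin θ ^ (1 : ℤ) : ℝ) : ℂ)) (fun j θ hθ => by
      have hs := (Real.sin_pos_of_mem_Ioo hθ).ne'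
      rw [← Complex.ofReal_mul, deriv_smoothQ_eq_sin_mul hM, zpow_one]
      congr 1
      field_simp) hg hgs hbs
    (fun t => (sq_le_of_sum_le zero_le_one (energy t)).1)
  obtain ⟨hk0, hks0⟩ := exists_mul_of_hasSum (sqInt_smoothQ M) h0
    (κ := fun θ => (((M : ℝ) ^ 2 / Real.sin θ ^ (2 : ℤ) : ℝ) : ℂ)) (fun j θ hθ => by
      have hs := (Real.sin_pos_of_mem_Ioo hθ).ne'
      rw [← Complex.ofReal_mul, smoothQ_eq_sin_sq_mul hM, zpow_ofNat]
      congr 1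
      field_simp) hf (hf.hasSum_smoothQ M) hbs
    -- `sq_le_of_sum_le` isolates only the last two squares, so the first two are exchanged.
    (fun t => (sq_le_of_sum_le zero_le_one ((by linarith [energy t] :
      1 * ‖∑ j ∈ t, a j • (h1 j).toL2‖ ^ 2 + ‖∑ j ∈ t, a j • (h0 j).toL2‖ ^ 2 +
        ‖∑ j ∈ t, a j • (h2 j).toL2‖ ^ 2 ≤ ∑ j ∈ t, b j))).1)
  refine ⟨g, h, hfg, hgh, ?_⟩
  have key := norm_sq_add_le_of_hasSum hks0 hks1 hhs hbs hb0 1 energy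
  have e1 := sinInt_one_mul M 1 g
  have e0 := sinInt_one_mul ((M : ℝ) ^ 2) 2 f
  rw [show (1 : ℤ) - 2 * 1 = -1 by norm_num] at e1
  rw [show (1 : ℤ) - 2 * 2 = -3 by norm_num, ← pow_mul] at e0
  rw [← e1, ← e0, hk0.sinInt_eq_enorm, hk1.sinInt_eq_enorm, hh.sinInt_eq_enorm, enorm_sq_eq_ofReal,
    enorm_sq_eq_ofReal, enorm_sq_eq_ofReal, ← ENNReal.ofReal_add (by positivity) (by positivity),
    ← ENNReal.ofReal_add (by positivity) (by positivity),
    ← ENNReal.ofReal_tsum_of_nonneg hb0 hbs]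
  rw [one_mul] at key
  exact ENNReal.ofReal_le_ofReal key

/-! ### Reduction of the spherical norm to one Fourier mode -/

theorem expMode_mul_conj (m k : ℤ) (φ : ℝ) :
    expMode m φ * (starRingEnd ℂ) (expMode k φ) =
      (1 / (2 * Real.pi) : ℝ) * Complex.exp (Complex.I * ((m - k : ℤ) : ℂ) * φ) := by
  have h : (1 / √(2 * Real.pi)) * (1 / √(2 * Real.pi)) = 1 / (2 * Real.pi) := by
    rw [div_mul_div_comm, Real.mul_self_sqrt (by positivity), one_mul]
  rw [expMode, expMode, map_mul, Complex.conj_ofReal, ← Complex.exp_conj, mul_mul_mul_comm,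
    ← Complex.ofReal_mul, h, ← Complex.exp_add]
  congr 2
  simp only [map_mul, Complex.conj_I, Complex.conj_ofReal, map_intCast]
  push_cast
  ring

theorem integral_expMode_mul_conj (m k : ℤ) :
    ∫ φ in (0 : ℝ)..(2 * Real.pi), expMode m φ * (starRingEnd ℂ) (expMode k φ) =
      if k = m then 1 else 0 := by
  simp only [expMode_mul_conj, intervalIntegral.integral_const_mul]
  split_ifs with h
  · subst h
    have : (Real.pi : ℂ) ≠ 0 := by exact_mod_cast Real.pi_ne_zero
    simp
    field_simp
  · have hc : Complex.I * ((m - k : ℤ) : ℂ) ≠ 0 :=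
      mul_ne_zero Complex.I_ne_zero (by exact_mod_cast sub_ne_zero.2 (Ne.symm h))
    rw [integral_exp_mul_complex hc]
    have e : Complex.exp (Complex.I * ((m - k : ℤ) : ℂ) * ((2 * Real.pi : ℝ) : ℂ)) = 1 := by
      rw [Complex.exp_eq_one_iff]
      exact ⟨m - k, by push_cast; ring⟩
    rw [e]
    simp

theorem sphCoeff_tensorMode (f : ℝ → ℂ) (m k : ℤ) (n : ℕ) :
    sphCoeff (tensorMode f m) n k = if k = m then (-1 : ℂ) ^ ((m + |m|) / 2) *
      ∫ θ in (0 : ℝ)..Real.pi, ((Real.sin θ * legendreQ n m θ : ℝ) : ℂ) * f θ else 0 := by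
  have e : ∀ θ : ℝ, ∫ φ in (0 : ℝ)..(2 * Real.pi), tensorMode f m (θ, φ) *
      (starRingEnd ℂ) (sphericalY n k θ φ) * (Real.sin θ : ℂ) =
      ((-1 : ℂ) ^ ((k + |k|) / 2) * (((Real.sin θ * legendreQ n k θ : ℝ) : ℂ) * f θ)) *
        if k = m then 1 else 0 := by
    intro θ
    rw [← integral_expMode_mul_conj, ← intervalIntegral.integral_const_mul]
    refine intervalIntegral.integral_congr fun φ _ => ?_
    simp only [tensorMode, sphericalY, map_mul, map_zpow₀, map_neg, map_one, Complex.conj_ofReal]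
    push_cast
    ring
  rw [sphCoeff]
  simp only [e]
  split_ifs with h
  · subst h
    simp only [mul_one, intervalIntegral.integral_const_mul]
  · simp

theorem enorm_sphCoeff_tensorMode (f : ℝ → ℂ) (m : ℤ) (j : ℕ) :
    ‖sphCoeff (tensorMode f m) (m.natAbs + j) m‖ₑ = ‖legendreCoeff m.natAbs j f‖ₑ := by
  have e : ∫ θ in (0 : ℝ)..Real.pi, ((Real.sin θ * legendreQ (m.natAbs + j) m θ : ℝ) : ℂ) * f θ =
      legendreCoeff m.natAbs j f := by
    rw [intervalIntegral.integral_of_le Real.pi_pos.le, integral_Ioc_eq_integral_Ioo, legendreCoeff]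
    refine setIntegral_congr_fun measurableSet_Ioo fun θ hθ => ?_
    simp only [legendreQ_eq_smoothQ m j (Ioo_subset_Icc_self hθ)]
  have h1 : ‖(-1 : ℂ) ^ ((m + |m|) / 2)‖ₑ = 1 := by
    rw [← ofReal_norm, norm_zpow, norm_neg, norm_one, one_zpow, ENNReal.ofReal_one]
  rw [sphCoeff_tensorMode, if_pos rfl, e, enorm_mul, h1, one_mul]

/-- Orthogonality in φ kills every order but m, and order m occurs only in degrees n ≥ |m|, whence n
= |m| + j. -/
theorem wNorm_eq (m : ℤ) (s : ℝ) (f : ℝ → ℂ) :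
    wNorm m s f = (∑' j : ℕ, ENNReal.ofReal (((m.natAbs : ℝ) + j + 1 / 2) ^ (2 * s)) *
      ‖legendreCoeff m.natAbs j f‖ₑ ^ 2) ^ (1 / 2 : ℝ) := by
  set F : ℕ → ENNReal := fun n => ∑ k ∈ Finset.Icc (-(n : ℤ)) (n : ℤ),
    ENNReal.ofReal (((n : ℝ) + 1 / 2) ^ (2 * s)) * ‖sphCoeff (tensorMode f m) n k‖ₑ ^ 2 with hF
  have hz : ∀ n k, k ≠ m → ‖sphCoeff (tensorMode f m) n k‖ₑ ^ 2 = 0 := fun n k hk => by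
    rw [sphCoeff_tensorMode, if_neg hk]
    simp
  have hinj : Function.Injective fun j : ℕ => m.natAbs + j := fun i j h => by simpa using h
  have hsupp : Function.support F ⊆ Set.range fun j : ℕ => m.natAbs + j := by
    intro n hn
    by_contra hr
    refine hn (Finset.sum_eq_zero fun k hk => ?_)
    rw [hz n k, mul_zero]
    rintro rfl
    rw [Finset.mem_Icc] at hk
    exact hr ⟨n - k.natAbs, by simp only; omega⟩
  rw [wNorm, hNorm]
  change (∑' n, F n) ^ (1 / 2 : ℝ) = _
  rw [← hinj.tsum_eq hsupp]
  congr 1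
  refine tsum_congr fun j => ?_
  have hm : m ∈ Finset.Icc (-((m.natAbs + j : ℕ) : ℤ)) ((m.natAbs + j : ℕ) : ℤ) := by
    rw [Finset.mem_Icc]
    omega
  simp only [hF]
  rw [Finset.sum_eq_single_of_mem m hm fun k _ hk => by rw [hz _ k hk, mul_zero],
    enorm_sphCoeff_tensorMode, Nat.cast_add]

theorem wNorm_one_eq (m : ℤ) (f : ℝ → ℂ) :
    wNorm m 1 f = (∑' j : ℕ, ENNReal.ofReal (((m.natAbs : ℝ) + j + 1 / 2) ^ 2) *
      ‖legendreCoeff m.natAbs j f‖ₑ ^ 2) ^ (1 / 2 : ℝ) := by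
  rw [wNorm_eq, show (2 * 1 : ℝ) = ((2 : ℕ) : ℝ) by norm_num]
  simp only [Real.rpow_natCast]

theorem wNorm_two_eq (m : ℤ) (f : ℝ → ℂ) :
    wNorm m 2 f = (∑' j : ℕ, ENNReal.ofReal (((m.natAbs : ℝ) + j + 1 / 2) ^ 4) *
      ‖legendreCoeff m.natAbs j f‖ₑ ^ 2) ^ (1 / 2 : ℝ) := by
  rw [wNorm_eq, show (2 * 2 : ℝ) = ((4 : ℕ) : ℝ) by norm_num]
  simp only [Real.rpow_natCast]

theorem enorm_expMode (m : ℤ) (φ : ℝ) : ‖expMode m φ‖ₑ = ENNReal.ofReal (1 / √(2 * Real.pi)) := by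
  rw [← ofReal_norm, expMode, norm_mul, Complex.norm_real, Real.norm_of_nonneg (by positivity),
    show Complex.I * (m : ℂ) * φ = ((m * φ : ℝ) : ℂ) * Complex.I by push_cast; ring,
    Complex.norm_exp_ofReal_mul_I, mul_one]

/-- By Tonelli, as |e_m| is constant. All later estimates need only this consequence of membership.
-/
theorem sqInt_of_mem_W {m : ℤ} {f : ℝ → ℂ} (h : f ∈ W m 0) : SqInt 1 f := by
  have hfm : AEStronglyMeasurable f arc := h.1.aestronglyMeasurable.restrict
  have hlt := h.2.1.2.2
  refine sqInt_of_sinInt_ne_top hfm fun htop => hlt.ne ?_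
  have e : ∀ p : ℝ × ℝ, ‖tensorMode f m p‖ₑ ^ 2 * ENNReal.ofReal (Real.sin p.1) =
      (‖f p.1‖ₑ ^ 2 * ENNReal.ofReal (Real.sin p.1 ^ (1 : ℤ))) *
        ENNReal.ofReal (1 / √(2 * Real.pi)) ^ 2 := fun p => by
    rw [tensorMode, enorm_mul, enorm_expMode, zpow_one]
    ring
  simp only [e]
  rw [Measure.volume_eq_prod, ← Measure.prod_restrict,
    lintegral_prod_mul (f := fun θ => ‖f θ‖ₑ ^ 2 * ENNReal.ofReal (Real.sin θ ^ (1 : ℤ)))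
      (g := fun _ => ENNReal.ofReal (1 / √(2 * Real.pi)) ^ 2) (aemeasurable_sinInt hfm 1)
      aemeasurable_const]
  change sinInt 1 f * _ = ⊤
  rw [htop, lintegral_const, Measure.restrict_apply_univ, Real.volume_Ioo]
  refine ENNReal.top_mul (mul_ne_zero (pow_ne_zero _ ?_) ?_)
  · exact (ENNReal.ofReal_pos.2 (by positivity)).ne'
  · exact (ENNReal.ofReal_pos.2 (by linarith [Real.pi_pos])).ne'

/-! ### The norm inequalities -/

theorem ofReal_mul_rpow_half {c : ℝ} (hc : 0 ≤ c) (X : ENNReal) :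
    ENNReal.ofReal c * X ^ (1 / 2 : ℝ) = (ENNReal.ofReal (c ^ 2) * X) ^ (1 / 2 : ℝ) := by
  rw [ENNReal.mul_rpow_of_nonneg _ _ (by norm_num), ENNReal.ofReal_rpow_of_nonneg (by positivity)
    (by norm_num), ← Real.sqrt_eq_rpow, Real.sqrt_sq hc]

theorem rpow_half_mono {X Y : ENNReal} (h : X ≤ Y) : X ^ (1 / 2 : ℝ) ≤ Y ^ (1 / 2 : ℝ) :=
  ENNReal.rpow_le_rpow h (by norm_num)

theorem top_rpow_half : (⊤ : ENNReal) ^ (1 / 2 : ℝ) = ⊤ :=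
  ENNReal.top_rpow_of_pos (by norm_num)

theorem zNormZero_le_wNorm_one (m : ℤ) {f : ℝ → ℂ} (hf : SqInt 1 f) :
    zNormZero f ≤ wNorm m 1 f := by
  rw [wNorm_one_eq]
  by_cases hs : ∑' j : ℕ, ENNReal.ofReal (((m.natAbs : ℝ) + j + 1 / 2) ^ 2) *
      ‖legendreCoeff m.natAbs j f‖ₑ ^ 2 = ⊤
  · rw [hs, top_rpow_half]; exact le_top
  · obtain ⟨g, -, hw, -, hle⟩ := exists_weakDeriv_first_order hf hs
    refine iInf₂_le_of_le g hw (rpow_half_mono (le_trans ?_ hle))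
    gcongr
    exact le_self_add

theorem wNorm_zero_one_eq_zNormZero {f : ℝ → ℂ} (hf : SqInt 1 f) :
    wNorm 0 1 f = zNormZero f := by
  refine le_antisymm ?_ (zNormZero_le_wNorm_one 0 hf)
  rw [wNorm_one_eq]
  refine le_iInf₂ fun g hw => rpow_half_mono ?_
  simpa using tsum_coeff_le_first_order (M := 0) hw hf

theorem natAbs_cast_pow_even (m : ℤ) {n : ℕ} (hn : Even n) :
    (m.natAbs : ℝ) ^ n = (m : ℝ) ^ n := by
  rw [Nat.cast_natAbs, Int.cast_abs, hn.pow_abs]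

theorem sinInt_one_le_sinInt_neg_one (f : ℝ → ℂ) : sinInt 1 f ≤ sinInt (-1) f := by
  refine lintegral_mono_ae ?_
  filter_upwards [ae_arc_mem] with θ hθ
  gcongr ?_ * ENNReal.ofReal ?_
  · exact le_rfl
  · exact zpow_le_zpow_right_of_le_one₀ (Real.sin_pos_of_mem_Ioo hθ) (Real.sin_le_one θ)
      (by norm_num)

theorem wNorm_one_le_zNormOne {m : ℤ} (hm : 1 ≤ |m|) {f : ℝ → ℂ} (hf : SqInt 1 f) :
    wNorm m 1 f ≤ ENNReal.ofReal (√5 / 2) * zNormOne m f := by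
  have hc0 : ENNReal.ofReal (√5 / 2) ≠ 0 := (ENNReal.ofReal_pos.2 (by positivity)).ne'
  rw [zNormOne, ENNReal.mul_iInf_of_ne hc0 ENNReal.ofReal_ne_top]
  refine le_iInf fun g => ?_
  rw [ENNReal.mul_iInf_of_ne hc0 ENNReal.ofReal_ne_top]
  refine le_iInf fun hw => ?_
  rw [wNorm_one_eq, ofReal_mul_rpow_half (by positivity)]
  refine rpow_half_mono ((tsum_coeff_le_first_order hw hf).trans ?_)
  have hm1 : (1 : ℝ) ≤ (m : ℝ) ^ 2 := by
    rw [one_le_sq_iff_one_le_abs]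
    exact_mod_cast hm
  have h1 : sinInt 1 f ≤ ENNReal.ofReal ((m : ℝ) ^ 2) * sinInt (-1) f := by
    refine (sinInt_one_le_sinInt_neg_one f).trans ?_
    nth_rewrite 1 [← one_mul (sinInt (-1) f)]
    gcongr
    rw [← ENNReal.ofReal_one]
    exact ENNReal.ofReal_le_ofReal hm1
  rw [natAbs_cast_pow_even m even_two]
  set A := ENNReal.ofReal ((m : ℝ) ^ 2) * sinInt (-1) f
  -- The extra 1/4 ∫ |f|² sin is at most a quarter of m² ∫ |f|² / sin, hence the factor 5/4.
  have h54 : ENNReal.ofReal ((√5 / 2) ^ 2) = ENNReal.ofReal (1 / 4) + 1 := by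
    rw [← ENNReal.ofReal_one, ← ENNReal.ofReal_add (by norm_num) (by norm_num), div_pow,
      Real.sq_sqrt (by norm_num)]
    norm_num
  calc ENNReal.ofReal (1 / 4) * sinInt 1 f + A + sinInt 1 g
      ≤ ENNReal.ofReal (1 / 4) * A + A + sinInt 1 g := by gcongr
    _ ≤ ENNReal.ofReal (1 / 4) * A + A + (ENNReal.ofReal (1 / 4) * sinInt 1 g + sinInt 1 g) := by
        gcongr; exact le_add_self
    _ = _ := by rw [h54]; ring

theorem zNormOne_le_wNorm_one (m : ℤ) {f : ℝ → ℂ} (hf : SqInt 1 f) :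
    zNormOne m f ≤ wNorm m 1 f := by
  rw [wNorm_one_eq]
  by_cases hs : ∑' j : ℕ, ENNReal.ofReal (((m.natAbs : ℝ) + j + 1 / 2) ^ 2) *
      ‖legendreCoeff m.natAbs j f‖ₑ ^ 2 = ⊤
  · rw [hs, top_rpow_half]; exact le_top
  · obtain ⟨g, -, hw, -, hle⟩ := exists_weakDeriv_first_order hf hs
    refine iInf₂_le_of_le g hw (rpow_half_mono (le_trans ?_ hle))
    rw [natAbs_cast_pow_even m even_two]
    gcongr
    exact le_add_self

theorem two_le_natAbs {m : ℤ} (hm : 2 ≤ |m|) : 2 ≤ m.natAbs := by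
  rw [Int.abs_eq_natAbs] at hm
  exact_mod_cast hm

theorem wNorm_two_le_zNormTwo {m : ℤ} (hm : 2 ≤ |m|) {f : ℝ → ℂ} (hf : SqInt 1 f) :
    ENNReal.ofReal (1 / √3) * wNorm m 2 f ≤ zNormTwo m f := by
  refine le_iInf₂ fun g h => le_iInf fun hw => ?_
  rw [wNorm_two_eq, ofReal_mul_rpow_half (by positivity)]
  refine rpow_half_mono ?_
  have key := tsum_coeff_le_second_order (M := m.natAbs) (two_le_natAbs hm) hw.1 hw.2 hf
  rw [natAbs_cast_pow_even m even_two, natAbs_cast_pow_even m (by decide : Even 4)] at key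
  have h3 : ENNReal.ofReal ((1 / √3) ^ 2) * 3 = 1 := by
    rw [div_pow, Real.sq_sqrt (by norm_num), one_pow,
      show (3 : ENNReal) = ENNReal.ofReal 3 by simp, ← ENNReal.ofReal_mul (by norm_num)]
    norm_num
  calc _ ≤ ENNReal.ofReal ((1 / √3) ^ 2) * (3 * _) := mul_le_mul_right key _
    _ = _ := by rw [← mul_assoc, h3, one_mul]

theorem zNormTwo_le_wNorm_two {m : ℤ} (hm : 2 ≤ |m|) {f : ℝ → ℂ} (hf : SqInt 1 f) :
    zNormTwo m f ≤ ENNReal.ofReal √3 * wNorm m 2 f := by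
  rw [wNorm_two_eq]
  by_cases hs : ∑' j : ℕ, ENNReal.ofReal (((m.natAbs : ℝ) + j + 1 / 2) ^ 4) *
      ‖legendreCoeff m.natAbs j f‖ₑ ^ 2 = ⊤
  · rw [hs, top_rpow_half, ENNReal.mul_top (ENNReal.ofReal_pos.2 (by positivity)).ne']
    exact le_top
  · obtain ⟨g, h, hw1, hw2, hle⟩ := exists_weakDeriv_second_order (two_le_natAbs hm) hf hs
    rw [ofReal_mul_rpow_half (by positivity), Real.sq_sqrt (by norm_num), ENNReal.ofReal_ofNat]
    refine iInf₂_le_of_le g h (iInf_le_of_le ⟨hw1, hw2⟩ (rpow_half_mono ?_))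
    rwa [natAbs_cast_pow_even m even_two, natAbs_cast_pow_even m (by decide : Even 4)] at hle

end SphereSobolev

end

open SphereSobolev
theorem theorem3p1 :
    (∀ f ∈ W 0 0, wNorm 0 1 f = zNormZero f) ∧
    (∀ m : ℤ, 1 ≤ |m| → ∀ f ∈ W m 0,
      wNorm 0 1 f = zNormZero f ∧
      zNormZero f ≤ wNorm m 1 f ∧
      wNorm m 1 f ≤ ENNReal.ofReal (√5 / 2) * zNormOne m f ∧
      ENNReal.ofReal (√5 / 2) * zNormOne m f ≤ ENNReal.ofReal (√5 / 2) * wNorm m 1 f) ∧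
    (∀ m : ℤ, 2 ≤ |m| → ∀ f ∈ W m 0,
      ENNReal.ofReal (1 / √3) * wNorm m 2 f ≤ zNormTwo m f ∧
      zNormTwo m f ≤ ENNReal.ofReal (√3) * wNorm m 2 f) := by
  refine ⟨fun f hf => wNorm_zero_one_eq_zNormZero (sqInt_of_mem_W hf), fun m hm f hf => ?_,
    fun m hm f hf => ?_⟩
  · have h := sqInt_of_mem_W hf
    exact ⟨wNorm_zero_one_eq_zNormZero h, zNormZero_le_wNorm_one m h,
      wNorm_one_le_zNormOne hm h, mul_le_mul_right (zNormOne_le_wNorm_one m h) _⟩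
  · have h := sqInt_of_mem_W hf
    exact ⟨wNorm_two_le_zNormTwo hm h, zNormTwo_le_wNorm_two hm h⟩
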